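/- Fix a number of classes $c\ge 2$, class sizes $N_1,\dots,N_c\ge 1$ and signal strengths $s_1,\dots,s_c$. For each dimension $d$ let $\sigma=\sigma_d>0$ and $\mu_1,\dots,\mu_c\in\mathbb R^d$ (depending on $d$) be such that, for all sufficiently large $d$, $\sigma^2=1/d$, $\|\mu_i\|^2=s_i/\sqrt d$ and $\langle\mu_i,\mu_j\rangle=0$ for $i\ne j$. A training set $\mathcal D_d$ consists of $N_y$ examples of each class $y$, all independent, those of class $y$ having law $\mathcal N(\mu_y,\sigma^2 I_d)$; let $\bar x_i$ be the sum of the feature vectors of class $i$. For each $d$ let $\tilde\alpha_y=\tilde\alpha_y(d)\in\mathbb R^c$ $(y\in[c])$ and $\tilde b=\tilde b(d)\in\mathbb R^c$ be arbitrary deterministic coefficients, and consider the predictor $\tilde W=(\tilde w_1,\dots,\tilde w_c)$, $\tilde b$ with $\tilde w_y=\sum_{i=1}^c\tilde\alpha_{y[i]}\bar x_i$. For a predictor $(W,b)$ and a fresh test point $x\sim\mathcal N(\mu_y,\sigma^2I_d)$ put $\mathrm{Err}_y(W,b)=\mathbb P_x\big(y\notin\arg\max_i\{\langle w_i,x\rangle+b_{[i]}\}\big)$,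 $\mathrm{Err}_{y\to k}(W,b)=\mathbb P_x\big(\langle w_k,x\rangle+b_{[k]}>\langle w_y,x\rangle+b_{[y]}\big)$ and $\mathrm{WCE}(W,b)=\max_y\mathrm{Err}_y(W,b)$. The score statistics are $\nu^{(y)}_{[j]}=\sigma^{-1}\big(\langle w_y-w_j,\mu_y\rangle+b_{[y]}-b_{[j]}\big)$ and $\Sigma^{(y)}_{[i,j]}=\langle w_y-w_i,w_y-w_j\rangle$; let $\hat\nu^{(y)}$, $\hat\Sigma^{(y)}$ be the expectations over $\mathcal D_d$ of the score statistics of $(\tilde W,\tilde b)$. Let $Q(t)=\mathbb P(\mathcal N(0,1)>t)$ and $\xi_i=\|\mu_i\|^2+\sigma^2d/N_i$. Then the following hold, where convergence in probability is with respect to the random training set $\mathcal D_d$. 1. For every $d$ at which the above scaling holds, the expectations exist and $$\hat\nu^{(y)}_{[i]}=\frac{(\tilde\alpha_{y[y]}-\tilde\alpha_{i[y]})N_y\|\mu_y\|^2+\tilde b_{[y]}-\tilde b_{[i]}}{\sigma},\qquad \hat\Sigma^{(y)}_{[i,j]}=\sum_{z=1}^c(\tilde\alpha_{y[z]}-\tilde\alpha_{i[z]})(\tilde\alpha_{y[z]}-\tilde\alpha_{j[z]})N_z^2\xi_z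 .$$ 2. For every $y$, as $d\to\infty$, $$\mathrm{Err}_y(\tilde W,\tilde b)-\Big(1-\mathbb P\big[\mathcal N(\hat\nu^{(y)},\hat\Sigma^{(y)})\ge0\big]\Big)\longrightarrow0\quad\text{in probability}$$ (with $\ge 0$ coordinatewise). In particular, if $1-\mathbb P[\mathcal N(\hat\nu^{(y)},\hat\Sigma^{(y)})\ge0]$ has a limit as $d\to\infty$, then $\mathrm{Err}_y(\tilde W,\tilde b)$ converges in probability to that limit. Moreover $\mathrm{WCE}(\tilde W,\tilde b)-\max_y\big(1-\mathbb P[\mathcal N(\hat\nu^{(y)},\hat\Sigma^{(y)})\ge0]\big)\to0$ in probability. 3. For $k\ne y$ put $$Q_{y,k}(d)=Q\left(\frac{(\tilde\alpha_{y[y]}-\tilde\alpha_{k[y]})N_y\|\mu_y\|^2+\tilde b_{[y]}-\tilde b_{[k]}}{\sigma\sqrt{\sum_{i=1}^c(\tilde\alpha_{y[i]}-\tilde\alpha_{k[i]})^2N_i^2\xi_i}}\right).$$ If $\tilde\alpha_y\ne\tilde\alpha_k$ for all large $d$, then $\mathrm{Err}_{y\to k}(\tilde W,\tilde b)-Q_{y,k}(d)\to0$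 in probability. 4. If for every pair $k\ne y$ one has $\tilde\alpha_y\neq\tilde\alpha_k$ for all large $d$, then for every $\varepsilon>0$ the probability that $\mathrm{WCE}(\tilde W,\tilde b)<\max_{y,\,k\ne y}Q_{y,k}(d)-\varepsilon$ tends to $0$. In particular, if the limits $\lim_{d\to\infty}Q_{y,k}(d)$ exist for all $k\ne y$, then $\mathrm{Err}_{y\to k}(\tilde W,\tilde b)$ converges in probability to $\lim_{d\to\infty} Q_{y,k}(d)$ for all $k\neq y$, and, whenever $\mathrm{WCE}(\tilde W,\tilde b)$ converges in probability to a constant $\lim_{d\to\infty}\mathrm{WCE}$, $$\max_{y,\,k\ne y}\ \lim_{d\to\infty}Q_{y,k}(d)=\max_{y,\,k\ne y}\ \lim_{d\to\infty}\mathrm{Err}_{y\to k}(\tilde W,\tilde b)\ \le\ \lim_{d\to\infty}\mathrm{WCE}(\tilde W,\tilde b).$$ -/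

import Mathlib

open MeasureTheory ProbabilityTheory Filter Topology

noncomputable section

namespace ImbalancedMixture

/-! ### Linear predictors, errors -/

/-- The score vector `z = Wᵀ x + b`; the `k`-th column of `W` is `W k`. -/
def scores {c d : ℕ} (W : Fin c → EuclideanSpace ℝ (Fin d)) (b : Fin c → ℝ)
    (x : EuclideanSpace ℝ (Fin d)) (k : Fin c) : ℝ :=
  inner ℝ (W k) x + b k

open Classical in
/-- The 0-1 loss: `1` if `y` is not in the argmax set of `z`, and `0` otherwise. -/
def zeroOneLoss {c : ℕ} (z : Fin c → ℝ) (y : Fin c) : ℝ :=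
  if y ∈ {i | ∀ j, z j ≤ z i} then 0 else 1

/-- The class-conditional distribution `N(m, σ² I_d)`. -/
def classLaw {d : ℕ} (σ : ℝ) (m : EuclideanSpace ℝ (Fin d)) :
    Measure (EuclideanSpace ℝ (Fin d)) :=
  multivariateGaussian m (σ ^ 2 • (1 : Matrix (Fin d) (Fin d) ℝ))

/-- `Err_y(W, b)`: expected 0-1 loss on a test point `x | y ∼ N(μ_y, σ² I)`. -/
def err {c d : ℕ} (σ : ℝ) (μ : Fin c → EuclideanSpace ℝ (Fin d))
    (W : Fin c → EuclideanSpace ℝ (Fin d)) (b : Fin c → ℝ) (y : Fin c) : ℝ :=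
  ∫ x, zeroOneLoss (scores W b x) y ∂(classLaw σ (μ y))

/-- `Err_{y→k}(W, b)`: probability that class `k` scores strictly higher than the true class. -/
def errTo {c d : ℕ} (σ : ℝ) (μ : Fin c → EuclideanSpace ℝ (Fin d))
    (W : Fin c → EuclideanSpace ℝ (Fin d)) (b : Fin c → ℝ) (y k : Fin c) : ℝ :=
  (classLaw σ (μ y)).real {x | scores W b x k > scores W b x y}

/-- The worst class error `max_y Err_y(W, b)` (a maximum over a finite set). -/
def worstClassErr {c d : ℕ} (σ : ℝ) (μ : Fin c → EuclideanSpace ℝ (Fin d))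
    (W : Fin c → EuclideanSpace ℝ (Fin d)) (b : Fin c → ℝ) : ℝ :=
  ⨆ y, err σ μ W b y

/-! ### Training data -/

/-- A training set with `N k` feature vectors of class `k`. -/
abbrev Dataset {c : ℕ} (d : ℕ) (N : Fin c → ℕ) : Type :=
  (k : Fin c) → Fin (N k) → EuclideanSpace ℝ (Fin d)

/-- Law of the training set: all examples independent, those of class `k` with law
`N(μ_k, σ² I)`. -/
def trainLaw {c d : ℕ} (N : Fin c → ℕ) (σ : ℝ) (μ : Fin c → EuclideanSpace ℝ (Fin d)) :
    Measure (Dataset d N) :=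
  Measure.pi fun k => Measure.pi fun _ : Fin (N k) => classLaw σ (μ k)

/-- The scaling of the model parameters in dimension `d`, with signal strengths `s`. -/
structure ModelScaling {c : ℕ} (d : ℕ) (s : Fin c → ℝ) (σ : ℝ)
    (μ : Fin c → EuclideanSpace ℝ (Fin d)) : Prop where
  sigma_pos : 0 < σ
  sigma_sq : σ ^ 2 = 1 / (d : ℝ)
  norm_sq : ∀ i, ‖μ i‖ ^ 2 = s i / √(d : ℝ)
  orthogonal : ∀ i j, i ≠ j → inner ℝ (μ i) (μ j) = 0

/-- The sum `x̄_i` of the feature vectors of class `i`. -/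
def classSum {c d : ℕ} {N : Fin c → ℕ} (X : Dataset d N) (i : Fin c) :
    EuclideanSpace ℝ (Fin d) :=
  ∑ j, X i j

/-- The predictor `w̃_y = ∑ i, α_y[i] x̄_i`. -/
def weights {c d : ℕ} {N : Fin c → ℕ} (α : Fin c → Fin c → ℝ) (X : Dataset d N) (y : Fin c) :
    EuclideanSpace ℝ (Fin d) :=
  ∑ i, α y i • classSum X i

/-! ### Score statistics -/

/-- The score mean `ν^{(y)}` of a predictor. -/
def scoreMean {c d : ℕ} (σ : ℝ) (μ : Fin c → EuclideanSpace ℝ (Fin d))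
    (W : Fin c → EuclideanSpace ℝ (Fin d)) (b : Fin c → ℝ) (y j : Fin c) : ℝ :=
  (inner ℝ (W y - W j) (μ y) + b y - b j) / σ

/-- The score covariance `Σ^{(y)}` of a predictor. -/
def scoreCov {c d : ℕ} (W : Fin c → EuclideanSpace ℝ (Fin d)) (y i j : Fin c) : ℝ :=
  inner ℝ (W y - W i) (W y - W j)

/-- `ν̂^{(y)}`: expectation over the training data of the score mean of the predictor with
coefficients `α`, `b`. -/
def expScoreMean {c d : ℕ} (N : Fin c → ℕ) (σ : ℝ) (μ : Fin c → EuclideanSpace ℝ (Fin d))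
    (α : Fin c → Fin c → ℝ) (b : Fin c → ℝ) (y : Fin c) : EuclideanSpace ℝ (Fin c) :=
  WithLp.toLp 2 fun i => ∫ X : Dataset d N, scoreMean σ μ (weights α X) b y i ∂(trainLaw N σ μ)

/-- `Σ̂^{(y)}`: expectation over the training data of the score covariance of the predictor with
coefficients `α`. -/
def expScoreCov {c d : ℕ} (N : Fin c → ℕ) (σ : ℝ) (μ : Fin c → EuclideanSpace ℝ (Fin d))
    (α : Fin c → Fin c → ℝ) (y : Fin c) : Matrix (Fin c) (Fin c) ℝ :=
  Matrix.of fun i j => ∫ X : Dataset d N, scoreCov (weights α X) y i j ∂(trainLaw N σ μ)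

/-- `ξ_i = ‖μ_i‖² + σ² d / N_i`. -/
def xi {c d : ℕ} (N : Fin c → ℕ) (σ : ℝ) (μ : Fin c → EuclideanSpace ℝ (Fin d)) (i : Fin c) : ℝ :=
  ‖μ i‖ ^ 2 + σ ^ 2 * d / N i

/-- `1 - P(N(ν̂^{(y)}, Σ̂^{(y)}) ≥ 0)`, the inequality being coordinatewise. -/
def approxErr {c d : ℕ} (N : Fin c → ℕ) (σ : ℝ) (μ : Fin c → EuclideanSpace ℝ (Fin d))
    (α : Fin c → Fin c → ℝ) (b : Fin c → ℝ) (y : Fin c) : ℝ :=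
  1 - (multivariateGaussian (expScoreMean N σ μ α b y) (expScoreCov N σ μ α y)).real
    {v | ∀ i, 0 ≤ v i}

/-- The Gaussian tail function `Q(t) = P(N(0,1) > t)`. -/
def gaussianQ (t : ℝ) : ℝ := (gaussianReal 0 1).real (Set.Ioi t)

/-- The `Q`-function term of the pair `y`, `k`. -/
def approxErrTo {c d : ℕ} (N : Fin c → ℕ) (σ : ℝ) (μ : Fin c → EuclideanSpace ℝ (Fin d))
    (α : Fin c → Fin c → ℝ) (b : Fin c → ℝ) (y k : Fin c) : ℝ :=
  gaussianQ (((α y y - α k y) * N y * ‖μ y‖ ^ 2 + b y - b k) /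
    (σ * √(∑ i, (α y i - α k i) ^ 2 * (N i : ℝ) ^ 2 * xi N σ μ i)))

/-- The maximum of `f y k` over all pairs of distinct classes `k ≠ y`. -/
def maxPairs {c : ℕ} (f : Fin c → Fin c → ℝ) : ℝ :=
  ⨆ p : {p : Fin c × Fin c // p.2 ≠ p.1}, f p.1.1 p.1.2

/-! ### Convergence in probability along a sequence of probability spaces -/

/-- `F d - a d → 0` in probability, where `F d` lives on the probability space `(Ω d, P d)` and
`a d` is deterministic. For constant `a` this is convergence in probability to a constant. -/
def TendstoInProb {Ω : ℕ → Type} [∀ d, MeasurableSpace (Ω d)] (P : ∀ d, Measure (Ω d))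
    (F : ∀ d, Ω d → ℝ) (a : ℕ → ℝ) : Prop :=
  ∀ ε : ℝ, 0 < ε → Tendsto (fun d => P d {ω | ε ≤ |F d ω - a d|}) atTop (𝓝 0)

end ImbalancedMixture

end

open ImbalancedMixture

open ImbalancedMixture

namespace ImbalancedMixture

open Matrix WithLp

/-! ### Affine images and densities of multivariate Gaussian measures -/

section Gaussian

variable {ι κ : Type*} [Fintype ι] [Fintype κ]

/-! Fix the training set. For a test point `x` of class `y`, the vector `t` with entries `⟨x̄_z, x⟩
/ σ` is Gaussian, with mean `⟨x̄_z, μ_y⟩ / σ` and covariance the Gram matrix of the class sums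
(`map_scaledScores_classLaw`). The law of `t` does not involve `α` or `b`. These enter only through
the region of `t` in which `y` wins or `k` beats `y`, a measurable set varying arbitrarily with `d`
(`err_eq`, `errTo_eq`).

Second moment bounds show that the Gram matrix tends to `diag(N_z)` in probability and that the mean
tends to `N_y s_y` at `y` and to `0` elsewhere. This limit is nondegenerate, and Gaussian laws are
continuous in total variation at a positive definite covariance
(`eventually_abs_multivariateGaussian_sub_le`). So the law of `t` is close to the deterministic
`N(approxMean, approxCov)`, uniformly over all measurable sets
(`eventually_abs_scaledScores_law_sub_le`). The uniformity is what permits arbitrary coefficients.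

The affine map that defines the regions sends `N(approxMean, approxCov)` exactly to `N(ν̂, Σ̂)`
(`map_scoreGap_approx`). Hence `approxErr` and the `Q` terms are probabilities of the same regions,
although `Σ̂` itself is singular. -/

theorem stdGaussian_eq_withDensity :
    stdGaussian (EuclideanSpace ℝ ι) = volume.withDensity fun x =>
      ENNReal.ofReal ((2 * Real.pi) ^ (-(Fintype.card ι : ℝ) / 2) * Real.exp (-(‖x‖ ^ 2 / 2))) := by
  have hint : Integrable fun x : EuclideanSpace ℝ ι =>
      (2 * Real.pi) ^ (-(Fintype.card ι : ℝ) / 2) * Real.exp (-(‖x‖ ^ 2 / 2)) := by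
    refine Integrable.const_mul ?_ _
    have h := (GaussianFourier.integrable_cexp_neg_mul_sq_norm_add (V := EuclideanSpace ℝ ι)
      (b := 1 / 2) (by norm_num) 0 0).norm
    refine h.congr (.of_forall fun x => ?_)
    have : -(1 / 2 : ℂ) * ‖x‖ ^ 2 + 0 * (inner ℝ 0 x : ℝ) = ((-(‖x‖ ^ 2 / 2) : ℝ) : ℂ) := by
      push_cast
      ring
    simp only [this, Complex.norm_exp, Complex.ofReal_re]
  have := isFiniteMeasure_withDensity_ofReal hint.2
  apply Measure.ext_of_charFun
  ext t
  rw [charFun_stdGaussian, charFun_apply, integral_withDensity_eq_integral_toReal_smul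
    (by fun_prop) (by simp)]
  have h := GaussianFourier.integral_cexp_neg_mul_sq_norm_add (V := EuclideanSpace ℝ ι)
      (b := 1 / 2) (by norm_num) Complex.I t
  have hpos : 0 < 2 * Real.pi := by positivity
  have hfun (x : EuclideanSpace ℝ ι) :
      (ENNReal.ofReal ((2 * Real.pi) ^ (-(Fintype.card ι : ℝ) / 2) *
        Real.exp (-(‖x‖ ^ 2 / 2)))).toReal • Complex.exp (inner ℝ x t * Complex.I) =
      ((2 * Real.pi) ^ (-(Fintype.card ι : ℝ) / 2) : ℝ) *
        Complex.exp (-(1 / 2) * ‖x‖ ^ 2 + Complex.I * inner ℝ t x) := by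
    rw [ENNReal.toReal_ofReal (by positivity), Complex.real_smul, Complex.ofReal_mul, mul_assoc,
      Complex.ofReal_exp, ← Complex.exp_add, real_inner_comm]
    push_cast
    congr 2
    ring
  simp_rw [hfun]
  rw [integral_const_mul, h, ← mul_assoc]
  -- The normalising constant cancels the mass of the Gaussian integral with `b = 1 / 2`, leaving
  -- the characteristic function of the standard Gaussian.
  have : ((2 * Real.pi) ^ (-(Fintype.card ι : ℝ) / 2) : ℝ) *
      ((Real.pi : ℂ) / (1 / 2)) ^ ((Module.finrank ℝ (EuclideanSpace ℝ ι) : ℂ) / 2) = 1 := by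
    rw [finrank_euclideanSpace]
    have : ((Real.pi : ℂ) / (1 / 2)) ^ ((Fintype.card ι : ℂ) / 2) =
      ((2 * Real.pi) ^ ((Fintype.card ι : ℝ) / 2) : ℝ) := by
      rw [Complex.ofReal_cpow hpos.le]
      push_cast
      congr 1
      ring
    rw [this, ← Complex.ofReal_mul, ← Real.rpow_add hpos]
    simp [neg_div]
  rw [this, one_mul, Complex.I_sq]
  congr 1
  ring

variable [DecidableEq ι] [DecidableEq κ]

/-- Comparing characteristic functions needs no invertibility. This matters because the `y`-th row
of `gapMatrix α y` vanishes, so the image covariance is singular in the main application. -/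
theorem multivariateGaussian_map_affine (m : EuclideanSpace ℝ ι) {S : Matrix ι ι ℝ}
    (hS : S.PosSemidef) (V : Matrix κ ι ℝ) (β : EuclideanSpace ℝ κ) :
    (multivariateGaussian m S).map (fun x => toLp 2 (V *ᵥ ofLp x) + β) =
      multivariateGaussian (toLp 2 (V *ᵥ ofLp m) + β) (V * S * Vᵀ) := by
  have hS' : (V * S * Vᵀ).PosSemidef := by
    simpa using hS.mul_mul_conjTranspose_same V
  have hinner (x : EuclideanSpace ℝ ι) (t : EuclideanSpace ℝ κ) :
      inner ℝ (toLp 2 (V *ᵥ ofLp x)) t = inner ℝ x (toLp 2 (Vᵀ *ᵥ ofLp t)) := by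
    simp only [EuclideanSpace.inner_eq_star_dotProduct, star_trivial]
    rw [mulVec_transpose, ← dotProduct_mulVec]
  have hmeas : Measurable
      (fun x : EuclideanSpace ℝ ι => (toLp 2 (V *ᵥ ofLp x) + β : EuclideanSpace ℝ κ)) := by
    refine Continuous.measurable ?_
    fun_prop
  have : IsProbabilityMeasure ((multivariateGaussian m S).map
      (fun x => (toLp 2 (V *ᵥ ofLp x) + β : EuclideanSpace ℝ κ))) :=
    Measure.isProbabilityMeasure_map hmeas.aemeasurable
  apply Measure.ext_of_charFun
  ext t
  have hL := charFun_multivariateGaussian (μ := m) hS (toLp 2 (Vᵀ *ᵥ ofLp t))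
  rw [charFun_apply] at hL
  rw [charFun_multivariateGaussian hS', charFun_apply, integral_map hmeas.aemeasurable
    (by fun_prop)]
  simp_rw [inner_add_left, hinner, Complex.ofReal_add, add_mul, Complex.exp_add]
  rw [integral_mul_const, hL, ← Complex.exp_add]
  congr 1
  have h1 : (toLp 2 (Vᵀ *ᵥ ofLp t) : EuclideanSpace ℝ ι) ⬝ᵥ
      S *ᵥ (toLp 2 (Vᵀ *ᵥ ofLp t) : EuclideanSpace ℝ ι) =
      ofLp t ⬝ᵥ (V * S * Vᵀ) *ᵥ ofLp t := by
    simp only [← mulVec_mulVec]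
    rw [dotProduct_mulVec (ofLp t), ← mulVec_transpose]
  rw [h1, inner_add_right, real_inner_comm (toLp 2 (V *ᵥ ofLp m)) t, hinner, real_inner_comm β t,
    real_inner_comm m]
  push_cast
  ring

/-- The density of `N(m, S)` with respect to the Lebesgue measure, for positive definite `S`. -/
noncomputable def gaussianDensity (m : EuclideanSpace ℝ ι) (S : Matrix ι ι ℝ)
    (x : EuclideanSpace ℝ ι) : ℝ :=
  (2 * Real.pi) ^ (-(Fintype.card ι : ℝ) / 2) * (√S.det)⁻¹ *
    Real.exp (-((ofLp x - ofLp m) ⬝ᵥ S⁻¹ *ᵥ (ofLp x - ofLp m) / 2))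

theorem gaussianDensity_nonneg (m : EuclideanSpace ℝ ι) (S : Matrix ι ι ℝ)
    (x : EuclideanSpace ℝ ι) : 0 ≤ gaussianDensity m S x := by
  unfold gaussianDensity
  positivity

theorem continuous_gaussianDensity (m : EuclideanSpace ℝ ι) (S : Matrix ι ι ℝ) :
    Continuous (gaussianDensity m S) := by
  unfold gaussianDensity
  fun_prop

open scoped MatrixOrder in
-- Change of variables in the definition of `N(m, S)` as the image of the standard Gaussian under `x
-- ↦ m + √S x`, whose Jacobian is `|det √S| = √(det S)`.
theorem multivariateGaussian_eq_withDensity (m : EuclideanSpace ℝ ι) {S : Matrix ι ι ℝ}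
    (hS : S.PosDef) :
    multivariateGaussian m S =
      volume.withDensity fun x => ENNReal.ofReal (gaussianDensity m S x) := by
  set A : Matrix ι ι ℝ := CFC.sqrt S with hA
  have hAA : A * A = S := CFC.sqrt_mul_sqrt_self _ hS.posSemidef.nonneg
  have hAsymm : Aᵀ = A := by
    have : IsSelfAdjoint A := (CFC.sqrt_nonneg S).isSelfAdjoint
    simpa [star_eq_conjTranspose] using this.star_eq
  have hdet : A.det * A.det = S.det := by rw [← det_mul, hAA]
  have hdet0 : A.det ≠ 0 := by
    intro h
    have := hS.det_pos
    rw [← hdet, h] at this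
    simp at this
  have hsqrt : √S.det = |A.det| := by rw [← hdet, Real.sqrt_mul_self_eq_abs]
  set L := toEuclideanCLM (n := ι) (𝕜 := ℝ) A with hL
  have hLdet : LinearMap.det (L : EuclideanSpace ℝ ι →ₗ[ℝ] EuclideanSpace ℝ ι) = A.det := by
    rw [hL, coe_toEuclideanCLM_eq_toEuclideanLin, toEuclideanLin_eq_toLin_orthonormal,
      LinearMap.det_toLin]
  have hvol : (volume : Measure (EuclideanSpace ℝ ι)).map (fun x => m + L x) =
      ENNReal.ofReal |A.det|⁻¹ • volume := by
    have h := Measure.map_linearMap_addHaar_eq_smul_addHaar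
      (volume : Measure (EuclideanSpace ℝ ι))
      (f := (L : EuclideanSpace ℝ ι →ₗ[ℝ] EuclideanSpace ℝ ι)) (by rwa [hLdet])
    have : (fun x => m + L x) = (fun x => m + x) ∘ L := rfl
    rw [this, ← Measure.map_map (by fun_prop) (by fun_prop)]
    rw [ContinuousLinearMap.coe_coe] at h
    rw [h, Measure.map_smul, map_add_left_eq_self, hLdet, abs_inv]
  have hvol' : (volume : Measure (EuclideanSpace ℝ ι)) =
      ENNReal.ofReal |A.det| • (volume : Measure (EuclideanSpace ℝ ι)).map (fun x => m + L x) := by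
    rw [hvol, smul_smul, ← ENNReal.ofReal_mul (abs_nonneg _),
      mul_inv_cancel₀ (by simpa using hdet0)]
    simp
  have hmeas : Measurable fun x : EuclideanSpace ℝ ι => m + L x := by fun_prop
  have hdens (x : EuclideanSpace ℝ ι) : |A.det| * gaussianDensity m S (m + L x) =
      (2 * Real.pi) ^ (-(Fintype.card ι : ℝ) / 2) * Real.exp (-(‖x‖ ^ 2 / 2)) := by
    have h1 : (ofLp (m + L x) - ofLp m) = A *ᵥ ofLp x := by
      simp [hL]
    have h2 : A *ᵥ ofLp x ⬝ᵥ S⁻¹ *ᵥ A *ᵥ ofLp x = ‖x‖ ^ 2 := by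
      have hu : IsUnit A.det := hdet0.isUnit
      have h3 : A * S⁻¹ * A = 1 := by
        rw [← hAA, Matrix.mul_inv_rev, ← mul_assoc, mul_nonsing_inv _ hu, one_mul,
          nonsing_inv_mul _ hu]
      rw [EuclideanSpace.real_norm_sq_eq]
      nth_rewrite 1 [← hAsymm]
      rw [mulVec_transpose, ← dotProduct_mulVec, mulVec_mulVec, mulVec_mulVec, h3, one_mulVec]
      simp [dotProduct, sq]
    rw [gaussianDensity, h1, h2, hsqrt]
    field_simp [abs_ne_zero.mpr hdet0]
  have hcont := continuous_gaussianDensity m S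
  ext P hP
  rw [multivariateGaussian, ← hA, ← hL, Measure.map_apply hmeas hP, withDensity_apply _ hP,
    stdGaussian_eq_withDensity, withDensity_apply _ (hmeas hP)]
  -- Lebesgue measure on the right is written as a multiple of its image under the affine map, so
  -- that both sides are integrals over the same preimage.
  conv_rhs => rw [hvol', Measure.restrict_smul, lintegral_smul_measure,
    setLIntegral_map hP (by fun_prop) hmeas, smul_eq_mul, ← lintegral_const_mul _ (by fun_prop)]
  simp_rw [← ENNReal.ofReal_mul (abs_nonneg A.det), hdens]

theorem integrable_gaussianDensity (m : EuclideanSpace ℝ ι) {S : Matrix ι ι ℝ}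
    (hS : S.PosDef) : Integrable (gaussianDensity m S) := by
  refine ⟨(continuous_gaussianDensity m S).aestronglyMeasurable, ?_⟩
  rw [hasFiniteIntegral_iff_ofReal (.of_forall (gaussianDensity_nonneg m S)),
    ← setLIntegral_univ, ← withDensity_apply _ .univ, ← multivariateGaussian_eq_withDensity m hS]
  exact measure_lt_top _ _

theorem multivariateGaussian_real_apply (m : EuclideanSpace ℝ ι) {S : Matrix ι ι ℝ}
    (hS : S.PosDef) {P : Set (EuclideanSpace ℝ ι)} (hP : MeasurableSet P) :
    (multivariateGaussian m S).real P = ∫ x in P, gaussianDensity m S x := by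
  rw [measureReal_def, multivariateGaussian_eq_withDensity m hS, withDensity_apply _ hP,
    integral_eq_lintegral_of_nonneg_ae (.of_forall (gaussianDensity_nonneg m S))
      (continuous_gaussianDensity m S).aestronglyMeasurable]

/-- Pointwise convergence of densities, the input to the Scheffé argument for total variation. -/
theorem continuousAt_gaussianDensity (m₀ : EuclideanSpace ℝ ι) {S₀ : Matrix ι ι ℝ}
    (hS₀ : 0 < S₀.det) (x : EuclideanSpace ℝ ι) :
    ContinuousAt (fun p : EuclideanSpace ℝ ι × Matrix ι ι ℝ => gaussianDensity p.1 p.2 x)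
      (m₀, S₀) := by
  have hinv : ContinuousAt (fun p : EuclideanSpace ℝ ι × Matrix ι ι ℝ => p.2⁻¹) (m₀, S₀) := by
    refine ContinuousAt.comp' (g := Inv.inv) (continuousAt_matrix_inv S₀ ?_) continuousAt_snd
    rw [Ring.inverse_eq_inv']
    exact continuousAt_inv₀ hS₀.ne'
  have hquad : Continuous fun q : (ι → ℝ) × Matrix ι ι ℝ => q.1 ⬝ᵥ q.2 *ᵥ q.1 / 2 := by
    fun_prop
  have hpair : ContinuousAt (fun p : EuclideanSpace ℝ ι × Matrix ι ι ℝ =>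
      ((ofLp x - ofLp p.1, p.2⁻¹) : (ι → ℝ) × Matrix ι ι ℝ)) (m₀, S₀) :=
    ContinuousAt.prodMk (by fun_prop) hinv
  have hdet : ContinuousAt (fun p : EuclideanSpace ℝ ι × Matrix ι ι ℝ => (√p.2.det)⁻¹)
      (m₀, S₀) := by
    exact ContinuousAt.inv₀ (by fun_prop) (Real.sqrt_pos.2 hS₀).ne'
  exact (continuousAt_const.mul hdet).mul
    (Real.continuous_exp.continuousAt.comp (hquad.continuousAt.comp hpair).neg)

/-- A multivariate Gaussian measure depends continuously on its parameters for the total variation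
distance, at every positive definite covariance. -/
theorem eventually_abs_multivariateGaussian_sub_le (m₀ : EuclideanSpace ℝ ι) {S₀ : Matrix ι ι ℝ}
    (hS₀ : S₀.PosDef) {ε : ℝ} (hε : 0 < ε) :
    ∀ᶠ p : EuclideanSpace ℝ ι × Matrix ι ι ℝ in 𝓝 (m₀, S₀), p.2.PosSemidef →
      ∀ P, MeasurableSet P →
        |(multivariateGaussian p.1 p.2).real P - (multivariateGaussian m₀ S₀).real P| ≤ ε := by
  have : FirstCountableTopology (Matrix ι ι ℝ) :=
    inferInstanceAs (FirstCountableTopology (ι → ι → ℝ))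
  -- Scheffé's trick: the positive part of the difference is dominated by the limit density alone,
  -- so no uniform bound on the nearby densities is needed.
  have hlim : Tendsto (fun p : EuclideanSpace ℝ ι × Matrix ι ι ℝ =>
      ∫ x, max (gaussianDensity m₀ S₀ x - gaussianDensity p.1 p.2 x) 0) (𝓝 (m₀, S₀))
      (𝓝 (∫ _ : EuclideanSpace ℝ ι, (0 : ℝ))) := by
    refine tendsto_integral_filter_of_dominated_convergence (gaussianDensity m₀ S₀)
      (.of_forall fun p => ?_) (.of_forall fun p => .of_forall fun x => ?_)
      (integrable_gaussianDensity m₀ hS₀) (.of_forall fun x => ?_)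
    · exact (((continuous_gaussianDensity m₀ S₀).sub (continuous_gaussianDensity p.1 p.2)).max
        continuous_const).aestronglyMeasurable
    · rw [Real.norm_of_nonneg (le_max_right _ _)]
      exact max_le (by linarith [gaussianDensity_nonneg p.1 p.2 x])
        (gaussianDensity_nonneg m₀ S₀ x)
    · have h := ((continuousAt_const (y := gaussianDensity m₀ S₀ x)).sub
        (continuousAt_gaussianDensity m₀ hS₀.det_pos x)).max (continuousAt_const (y := (0 : ℝ)))
      simpa [ContinuousAt] using h
  rw [integral_zero] at hlim
  have hdet : ∀ᶠ p : EuclideanSpace ℝ ι × Matrix ι ι ℝ in 𝓝 (m₀, S₀), p.2.det ≠ 0 := by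
    have : ContinuousAt (fun p : EuclideanSpace ℝ ι × Matrix ι ι ℝ => p.2.det) (m₀, S₀) := by
      fun_prop
    exact this.eventually_ne hS₀.det_pos.ne'
  filter_upwards [hlim.eventually_lt_const hε, hdet] with p hp hpdet hpsd
  have hpd : p.2.PosDef := hpsd.posDef_iff_isUnit.2 ((isUnit_iff_isUnit_det _).2 hpdet.isUnit)
  have hi₀ := integrable_gaussianDensity m₀ hS₀
  have hi := integrable_gaussianDensity p.1 hpd
  have key (P : Set (EuclideanSpace ℝ ι)) (hP : MeasurableSet P) :
      (multivariateGaussian m₀ S₀).real P - (multivariateGaussian p.1 p.2).real P ≤ ε := by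
    rw [multivariateGaussian_real_apply _ hS₀ hP, multivariateGaussian_real_apply _ hpd hP,
      ← integral_sub hi₀.integrableOn hi.integrableOn]
    have hmax := (hi₀.sub hi).sup (integrable_zero _ _ _)
    calc ∫ x in P, gaussianDensity m₀ S₀ x - gaussianDensity p.1 p.2 x
        ≤ ∫ x in P, max (gaussianDensity m₀ S₀ x - gaussianDensity p.1 p.2 x) 0 :=
          integral_mono (hi₀.sub hi).integrableOn hmax.integrableOn fun x => le_max_left _ _
      _ ≤ ∫ x, max (gaussianDensity m₀ S₀ x - gaussianDensity p.1 p.2 x) 0 :=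
          setIntegral_le_integral hmax (.of_forall fun x => le_max_right _ _)
      _ ≤ ε := hp.le
  intro P hP
  have h1 := key P hP
  -- Both measures have mass one, so the one-sided bound for the complement is the reverse bound for
  -- `P`.
  have h2 := key Pᶜ hP.compl
  rw [probReal_compl_eq_one_sub hP, probReal_compl_eq_one_sub hP] at h2
  exact abs_le.2 ⟨by linarith, by linarith⟩

end Gaussian

/-! ### Convergence in probability as convergence along a filter -/

section ProbFilter

variable {Ω : ℕ → Type} [∀ d, MeasurableSpace (Ω d)]

/-- The filter of the sets of pairs `(d, ω)` which have asymptotically full probability as the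
index `d` tends to infinity. -/
def probFilter (P : ∀ d, Measure (Ω d)) : Filter (Σ d, Ω d) where
  sets := {A | Tendsto (fun d => P d {ω | (⟨d, ω⟩ : Σ d, Ω d) ∉ A}) atTop (𝓝 0)}
  univ_sets := by simp
  sets_of_superset {A B} hA hAB := tendsto_of_tendsto_of_tendsto_of_le_of_le tendsto_const_nhds hA
    (fun _ => zero_le) fun _ => measure_mono fun _ h h' => h (hAB h')
  inter_sets {A B} hA hB := by
    have h := Tendsto.add (Set.mem_ofPred.1 hA) (Set.mem_ofPred.1 hB)
    rw [add_zero] at h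
    refine tendsto_of_tendsto_of_tendsto_of_le_of_le tendsto_const_nhds h
      (fun _ => zero_le) fun d => ?_
    refine (measure_mono fun ω hω => ?_).trans (measure_union_le _ _)
    simpa [imp_iff_not_or] using hω

variable {P : ∀ d, Measure (Ω d)}

theorem eventually_probFilter {p : (Σ d, Ω d) → Prop} :
    (∀ᶠ x in probFilter P, p x) ↔ Tendsto (fun d => P d {ω | ¬ p ⟨d, ω⟩}) atTop (𝓝 0) :=
  Iff.rfl

theorem tendsto_fst_probFilter : Tendsto Sigma.fst (probFilter P) atTop := by
  intro A hA
  refine tendsto_const_nhds.congr' ?_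
  filter_upwards [hA] with d hd
  simp [hd]

/-- Needed to pass inequalities to limits in probability. -/
theorem probFilter_neBot [∀ d, IsProbabilityMeasure (P d)] : (probFilter P).NeBot := by
  refine ⟨fun h => ?_⟩
  have h' : Tendsto (fun d => P d {ω | ¬ False}) atTop (𝓝 0) :=
    eventually_probFilter (p := fun _ => False).1 (h ▸ mem_bot)
  simp at h'

/-- Turns convergence in probability over varying spaces into an ordinary limit, so that the algebra
of limits and continuity arguments apply directly. -/
theorem tendstoInProb_iff {F : ∀ d, Ω d → ℝ} {a : ℕ → ℝ} :
    TendstoInProb P F a ↔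
      Tendsto (fun x : Σ d, Ω d => F x.1 x.2 - a x.1) (probFilter P) (𝓝 0) := by
  rw [Metric.tendsto_nhds]
  refine forall₂_congr fun ε _ => ?_
  rw [eventually_probFilter]
  simp

theorem tendstoInProb_const_iff {F : ∀ d, Ω d → ℝ} {l : ℝ} :
    TendstoInProb P F (fun _ => l) ↔
      Tendsto (fun x : Σ d, Ω d => F x.1 x.2) (probFilter P) (𝓝 l) := by
  rw [tendstoInProb_iff, tendsto_sub_nhds_zero_iff]

theorem tendstoInProb_of_eventually_abs_sub_le {F : ∀ d, Ω d → ℝ} {a : ℕ → ℝ}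
    (h : ∀ ε : ℝ, 0 < ε → ∀ᶠ x : Σ d, Ω d in probFilter P, |F x.1 x.2 - a x.1| ≤ ε) :
    TendstoInProb P F a := by
  rw [tendstoInProb_iff, Metric.tendsto_nhds]
  intro ε hε
  -- Halving `ε` turns the weak inequality into the strict one required here.
  filter_upwards [h (ε / 2) (half_pos hε)] with x hx
  rw [Real.dist_eq, sub_zero]
  linarith

theorem TendstoInProb.const_of_tendsto {F : ∀ d, Ω d → ℝ} {a : ℕ → ℝ} {l : ℝ}
    (h : TendstoInProb P F a) (ha : Tendsto a atTop (𝓝 l)) :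
    TendstoInProb P F fun _ => l := by
  rw [tendstoInProb_const_iff]
  have := (tendstoInProb_iff.1 h).add (ha.comp tendsto_fst_probFilter)
  simpa using this

/-- Chebyshev's inequality. All random fluctuations below are controlled through it. -/
theorem tendsto_probFilter_zero_of_lintegral_sq_le {F : ∀ d, Ω d → ℝ} {r : ℕ → ℝ}
    (hF : ∀ d, Measurable (F d)) (hr : Tendsto r atTop (𝓝 0))
    (h : ∀ᶠ d in atTop, ∫⁻ ω, ENNReal.ofReal (F d ω ^ 2) ∂P d ≤ ENNReal.ofReal (r d)) :
    Tendsto (fun x : Σ d, Ω d => F x.1 x.2) (probFilter P) (𝓝 0) := by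
  rw [Metric.tendsto_nhds]
  intro ε hε
  rw [eventually_probFilter]
  have hlim : Tendsto (fun d => ENNReal.ofReal (r d) / ENNReal.ofReal (ε ^ 2)) atTop (𝓝 0) := by
    have := ENNReal.Tendsto.div_const (ENNReal.tendsto_ofReal hr) (b := ENNReal.ofReal (ε ^ 2))
      (Or.inr (by positivity))
    simpa using this
  refine tendsto_of_tendsto_of_tendsto_of_le_of_le' tendsto_const_nhds hlim
    (.of_forall fun _ => zero_le) ?_
  filter_upwards [h] with d hd
  calc P d {ω | ¬ dist (F d ω) 0 < ε}
      ≤ P d {ω | ENNReal.ofReal (ε ^ 2) ≤ ENNReal.ofReal (F d ω ^ 2)} := by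
        refine measure_mono fun ω hω => ENNReal.ofReal_le_ofReal ?_
        simp only [Set.mem_ofPred_eq, dist_zero_right, Real.norm_eq_abs, not_lt] at hω
        rw [← sq_abs (F d ω)]
        gcongr
    _ ≤ (∫⁻ ω, ENNReal.ofReal (F d ω ^ 2) ∂P d) / ENNReal.ofReal (ε ^ 2) :=
        meas_ge_le_lintegral_div ((hF d).pow_const 2).ennreal_ofReal.aemeasurable
          (by positivity) ENNReal.ofReal_ne_top
    _ ≤ _ := by gcongr

end ProbFilter

/-! ### Moments of isotropic Gaussian measures -/

section Isotropic

variable {ι : Type*} [DecidableEq ι]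

theorem posSemidef_smul_one {v : ℝ} (hv : 0 ≤ v) : (v • (1 : Matrix ι ι ℝ)).PosSemidef :=
  PosSemidef.one.smul hv

variable [Fintype ι]

theorem integral_inner_multivariateGaussian (m u : EuclideanSpace ℝ ι) (S : Matrix ι ι ℝ) :
    ∫ x, inner ℝ x u ∂multivariateGaussian m S = inner ℝ m u := by
  simp_rw [real_inner_comm u]
  have := ContinuousLinearMap.integral_comp_comm (innerSL ℝ u)
    (IsGaussian.integrable_id (μ := multivariateGaussian m S))
  simpa using this

theorem memLp_inner_multivariateGaussian (m u : EuclideanSpace ℝ ι) (S : Matrix ι ι ℝ) :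
    MemLp (fun x => inner ℝ x u) 2 (multivariateGaussian m S) := by
  simp_rw [real_inner_comm u]
  exact IsGaussian.memLp_dual _ (innerSL ℝ u) 2 (by simp)

theorem integral_inner_sq_multivariateGaussian (m u : EuclideanSpace ℝ ι) {v : ℝ} (hv : 0 ≤ v) :
    ∫ x, inner ℝ x u ^ 2 ∂multivariateGaussian m (v • (1 : Matrix ι ι ℝ)) =
      inner ℝ m u ^ 2 + v * ‖u‖ ^ 2 := by
  have h1 := variance_eq_sub (memLp_inner_multivariateGaussian m u (v • (1 : Matrix ι ι ℝ)))
  rw [integral_inner_multivariateGaussian] at h1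
  have h2 := covarianceBilin_self
    (IsGaussian.memLp_two_id (μ := multivariateGaussian m (v • (1 : Matrix ι ι ℝ)))) u
  rw [covarianceBilin_multivariateGaussian (posSemidef_smul_one hv)] at h2
  simp_rw [real_inner_comm _ u] at h2
  rw [h1] at h2
  have h3 : u.ofLp ⬝ᵥ (v • (1 : Matrix ι ι ℝ)) *ᵥ u.ofLp = v * ‖u‖ ^ 2 := by
    rw [smul_mulVec, one_mulVec, dotProduct_smul, EuclideanSpace.real_norm_sq_eq]
    simp [dotProduct, sq]
  rw [h3] at h2
  simp only [Pi.pow_apply] at h2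
  linarith

theorem lintegral_inner_sq_multivariateGaussian (m u : EuclideanSpace ℝ ι) {v : ℝ} (hv : 0 ≤ v) :
    ∫⁻ x, ENNReal.ofReal (inner ℝ x u ^ 2) ∂multivariateGaussian m (v • (1 : Matrix ι ι ℝ)) =
      ENNReal.ofReal (inner ℝ m u ^ 2 + v * ‖u‖ ^ 2) := by
  rw [← integral_inner_sq_multivariateGaussian m u hv, ofReal_integral_eq_lintegral_ofReal
    (memLp_inner_multivariateGaussian m u _).integrable_sq (.of_forall fun _ => sq_nonneg _)]

theorem integrable_norm_sq_multivariateGaussian (m : EuclideanSpace ℝ ι) (S : Matrix ι ι ℝ) :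
    Integrable (fun x => ‖x‖ ^ 2) (multivariateGaussian m S) :=
  (IsGaussian.memLp_two_id (μ := multivariateGaussian m S)).integrable_norm_pow (by simp)

theorem integral_norm_sq_multivariateGaussian (m : EuclideanSpace ℝ ι) {v : ℝ} (hv : 0 ≤ v) :
    ∫ x, ‖x‖ ^ 2 ∂multivariateGaussian m (v • (1 : Matrix ι ι ℝ)) =
      ‖m‖ ^ 2 + v * Fintype.card ι := by
  have h (x : EuclideanSpace ℝ ι) :
      ‖x‖ ^ 2 = ∑ i, inner ℝ x (EuclideanSpace.single i (1 : ℝ)) ^ 2 := by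
    simp [EuclideanSpace.real_norm_sq_eq, EuclideanSpace.inner_single_right]
  rw [h m]
  simp_rw [h]
  rw [integral_finsetSum _ fun i _ => (memLp_inner_multivariateGaussian m _ _).integrable_sq]
  simp_rw [integral_inner_sq_multivariateGaussian m _ hv]
  simp [Finset.sum_add_distrib, mul_comm]

/-- Independent coordinates make the variance of the squared norm a sum over coordinates. -/
theorem multivariateGaussian_smul_one_eq_map (m : EuclideanSpace ℝ ι) {v : ℝ} (hv : 0 ≤ v) :
    multivariateGaussian m (v • (1 : Matrix ι ι ℝ)) =
      (Measure.pi fun _ : ι => gaussianReal 0 1).map fun g => √v • toLp 2 g + m := by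
  have h := multivariateGaussian_map_affine (0 : EuclideanSpace ℝ ι)
    (PosSemidef.one (n := ι) (R := ℝ)) (√v • (1 : Matrix ι ι ℝ)) m
  rw [multivariateGaussian_zero_one, ← map_pi_eq_stdGaussian, Measure.map_map (by fun_prop)
    (by fun_prop)] at h
  have hv' : √v • (1 : Matrix ι ι ℝ) * 1 * (√v • (1 : Matrix ι ι ℝ))ᵀ = v • 1 := by
    simp [smul_smul, Real.mul_self_sqrt hv]
  rw [hv'] at h
  convert! h.symm using 2
  · simp
  · ext g
    simp [smul_mulVec]

/-- The variance of the squared distance to the mean is linear in the dimension. -/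
theorem lintegral_norm_sub_sq_sub_sq (m : EuclideanSpace ℝ ι) {v : ℝ} (hv : 0 ≤ v) :
    ∫⁻ x, ENNReal.ofReal ((‖x - m‖ ^ 2 - v * Fintype.card ι) ^ 2)
        ∂multivariateGaussian m (v • (1 : Matrix ι ι ℝ)) =
      ENNReal.ofReal (v ^ 2 * (Fintype.card ι * Var[fun t => t ^ 2; gaussianReal 0 1])) := by
  have h2 : MemLp (fun t : ℝ => t ^ 2) 2 (gaussianReal 0 1) := by
    have h4 : Integrable (fun t : ℝ => ‖t‖ ^ 4) (gaussianReal 0 1) :=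
      (memLp_id_gaussianReal (μ := 0) (v := 1) 4).integrable_norm_pow (by simp)
    refine (memLp_two_iff_integrable_sq (by fun_prop)).2 (h4.congr (.of_forall fun t => ?_))
    simp [← pow_mul, Even.pow_abs (show Even 4 by decide)]
  have hmean : ∫ t, t ^ 2 ∂gaussianReal 0 1 = 1 := by
    have h := variance_eq_sub (memLp_id_gaussianReal (μ := 0) (v := 1) 2)
    simpa using h.symm
  -- The value of the one-coordinate variance is never needed, only that it does not depend on the
  -- dimension.
  have hvar := variance_sum_pi (ι := ι) (μ := fun _ => gaussianReal 0 1)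
    (X := fun _ t => t ^ 2) fun _ => h2
  have hcomp (i : ι) : MemLp (fun g : ι → ℝ => g i ^ 2) 2 (Measure.pi fun _ => gaussianReal 0 1) :=
    h2.comp_measurePreserving (measurePreserving_eval (fun _ : ι => gaussianReal 0 1) i)
  have hsum : MemLp (∑ i, fun g : ι → ℝ => g i ^ 2) 2 (Measure.pi fun _ => gaussianReal 0 1) := by
    have := memLp_finsetSum' Finset.univ fun i _ => hcomp i
    exact this
  have hE : ∫ g : ι → ℝ, (∑ i, fun g : ι → ℝ => g i ^ 2) g ∂(Measure.pi fun _ => gaussianReal 0 1) =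
      Fintype.card ι := by
    simp only [Finset.sum_apply]
    rw [integral_finsetSum _ fun i _ => (hcomp i).integrable (by norm_num)]
    have (i : ι) : ∫ g : ι → ℝ, g i ^ 2 ∂(Measure.pi fun _ => gaussianReal 0 1) = 1 := by
      rw [integral_comp_eval (μ := fun _ : ι => gaussianReal 0 1) (f := fun t : ℝ => t ^ 2)
        (by fun_prop), hmean]
    simp [this]
  rw [multivariateGaussian_smul_one_eq_map m hv, lintegral_map (by fun_prop) (by fun_prop)]
  have hpt (g : ι → ℝ) : (‖√v • toLp 2 g + m - m‖ ^ 2 - v * Fintype.card ι) ^ 2 =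
      v ^ 2 * ((∑ i, fun g : ι → ℝ => g i ^ 2) g - Fintype.card ι) ^ 2 := by
    rw [add_sub_cancel_right, norm_smul, mul_pow, EuclideanSpace.real_norm_sq_eq,
      Real.norm_eq_abs, sq_abs, Real.sq_sqrt hv, Finset.sum_apply]
    ring
  simp_rw [hpt, ENNReal.ofReal_mul (sq_nonneg v)]
  rw [lintegral_const_mul _ (by simp only [Finset.sum_apply]; fun_prop)]
  have hev := evariance_eq_lintegral_ofReal (∑ i, fun g : ι → ℝ => g i ^ 2)
    (Measure.pi fun _ => gaussianReal 0 1)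
  rw [hE, ← hsum.ofReal_variance_eq, hvar] at hev
  rw [← hev]
  simp

end Isotropic

/-! ### The class sums -/

section ClassSum

variable {c d : ℕ} (N : Fin c → ℕ) (σ : ℝ) (μ : Fin c → EuclideanSpace ℝ (Fin d))

instance : IsProbabilityMeasure (trainLaw N σ μ) := by
  unfold trainLaw classLaw
  infer_instance

theorem measurable_classSum (k : Fin c) :
    Measurable fun X : Dataset d N => classSum X k := by
  unfold classSum
  fun_prop

/-- Characteristic functions multiply over independent summands. The case `n = 0` is included, with
zero covariance. -/
theorem map_sum_classLaw (n : ℕ) (m : EuclideanSpace ℝ (Fin d)) :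
    (Measure.pi fun _ : Fin n => classLaw σ m).map (fun x => ∑ j, x j) =
      multivariateGaussian ((n : ℝ) • m) ((n * σ ^ 2) • (1 : Matrix (Fin d) (Fin d) ℝ)) := by
  unfold classLaw
  have : IsProbabilityMeasure ((Measure.pi fun _ : Fin n =>
    multivariateGaussian m (σ ^ 2 • (1 : Matrix (Fin d) (Fin d) ℝ))).map (fun x => ∑ j, x j)) :=
    Measure.isProbabilityMeasure_map (Measurable.aemeasurable (by fun_prop))
  apply Measure.ext_of_charFun
  rw [charFun_map_sum_pi_eq_prod]
  ext t
  rw [charFun_multivariateGaussian (posSemidef_smul_one (by positivity))]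
  simp only [Finset.prod_apply, Finset.prod_const,
    charFun_multivariateGaussian (posSemidef_smul_one (sq_nonneg σ))]
  rw [← Complex.exp_nat_mul]
  congr 1
  simp [inner_smul_right, smul_mulVec]
  ring

theorem map_classSum (k : Fin c) :
    (trainLaw N σ μ).map (fun X => classSum X k) =
      multivariateGaussian ((N k : ℝ) • μ k) ((N k * σ ^ 2) • (1 : Matrix (Fin d) (Fin d) ℝ)) := by
  have : ∀ k, IsProbabilityMeasure (classLaw σ (μ k)) := fun k => by
    unfold classLaw
    infer_instance
  rw [← map_sum_classLaw, trainLaw, ← (measurePreserving_eval (fun k =>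
    Measure.pi fun _ : Fin (N k) => classLaw σ (μ k)) k).map_eq, Measure.map_map (by fun_prop)
    (by fun_prop)]
  rfl

theorem indepFun_classSum {k l : Fin c} (hkl : k ≠ l) :
    IndepFun (fun X : Dataset d N => classSum X k) (fun X => classSum X l) (trainLaw N σ μ) := by
  have : ∀ k, IsProbabilityMeasure (classLaw σ (μ k)) := fun k => by
    unfold classLaw
    infer_instance
  exact (iIndepFun_pi (μ := fun k => Measure.pi fun _ : Fin (N k) => classLaw σ (μ k))
    (X := fun k (x : Fin (N k) → EuclideanSpace ℝ (Fin d)) => ∑ j, x j)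
    fun k => Measurable.aemeasurable (by fun_prop)).indepFun hkl

theorem map_classSum_prod {k l : Fin c} (hkl : k ≠ l) :
    (trainLaw N σ μ).map (fun X => (classSum X k, classSum X l)) =
      (multivariateGaussian ((N k : ℝ) • μ k)
        ((N k * σ ^ 2) • (1 : Matrix (Fin d) (Fin d) ℝ))).prod
      (multivariateGaussian ((N l : ℝ) • μ l)
        ((N l * σ ^ 2) • (1 : Matrix (Fin d) (Fin d) ℝ))) := by
  rw [← map_classSum, ← map_classSum]
  exact (indepFun_iff_map_prod_eq_prod_map_map (measurable_classSum N k).aemeasurable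
    (measurable_classSum N l).aemeasurable).1 (indepFun_classSum N σ μ hkl)

end ClassSum

/-! ### Moments of the class sums -/

section ClassSumMoments

variable {c d : ℕ} (N : Fin c → ℕ) (σ : ℝ) (μ : Fin c → EuclideanSpace ℝ (Fin d))

theorem integrable_inner_classSum (k : Fin c) (u : EuclideanSpace ℝ (Fin d)) :
    Integrable (fun X : Dataset d N => inner ℝ (classSum X k) u) (trainLaw N σ μ) := by
  have h := (memLp_inner_multivariateGaussian ((N k : ℝ) • μ k) u
    ((N k * σ ^ 2) • (1 : Matrix (Fin d) (Fin d) ℝ))).integrable one_le_two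
  rw [← map_classSum] at h
  exact h.comp_measurable (measurable_classSum N k)

theorem integral_inner_classSum (k : Fin c) (u : EuclideanSpace ℝ (Fin d)) :
    ∫ X : Dataset d N, inner ℝ (classSum X k) u ∂trainLaw N σ μ = N k * inner ℝ (μ k) u := by
  rw [← integral_map (f := fun x => inner ℝ x u) (measurable_classSum N k).aemeasurable
    (by fun_prop), map_classSum, integral_inner_multivariateGaussian, real_inner_smul_left]

theorem integrable_norm_sq_classSum (k : Fin c) :
    Integrable (fun X : Dataset d N => ‖classSum X k‖ ^ 2) (trainLaw N σ μ) := by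
  have h := integrable_norm_sq_multivariateGaussian ((N k : ℝ) • μ k)
    ((N k * σ ^ 2) • (1 : Matrix (Fin d) (Fin d) ℝ))
  rw [← map_classSum] at h
  exact h.comp_measurable (measurable_classSum N k)

theorem integral_norm_sq_classSum (k : Fin c) :
    ∫ X : Dataset d N, ‖classSum X k‖ ^ 2 ∂trainLaw N σ μ =
      (N k) ^ 2 * ‖μ k‖ ^ 2 + N k * σ ^ 2 * d := by
  rw [← integral_map (f := fun x => ‖x‖ ^ 2) (measurable_classSum N k).aemeasurable
    (by fun_prop), map_classSum, integral_norm_sq_multivariateGaussian _ (by positivity)]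
  simp [norm_smul, mul_pow]

theorem integrable_inner_classSum_classSum (k l : Fin c) :
    Integrable (fun X : Dataset d N => inner ℝ (classSum X k) (classSum X l))
      (trainLaw N σ μ) := by
  refine ((integrable_norm_sq_classSum N σ μ k).add (integrable_norm_sq_classSum N σ μ l)).mono'
    ((measurable_classSum N k).inner (measurable_classSum N l)).aestronglyMeasurable
    (.of_forall fun X => ?_)
  have := norm_inner_le_norm (𝕜 := ℝ) (classSum X k) (classSum X l)
  simp only [Pi.add_apply]
  nlinarith [sq_nonneg (‖classSum X k‖ - ‖classSum X l‖), sq_nonneg (‖classSum X k‖),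
    sq_nonneg ‖classSum X l‖]

theorem integral_inner_classSum_of_ne {k l : Fin c} (hkl : k ≠ l) :
    ∫ X : Dataset d N, inner ℝ (classSum X k) (classSum X l) ∂trainLaw N σ μ =
      N k * N l * inner ℝ (μ k) (μ l) := by
  have hi := integrable_inner_classSum_classSum N σ μ k l
  have hmeas := (measurable_classSum (d := d) N k).prodMk (measurable_classSum (d := d) N l)
  rw [← integral_map (f := fun p : EuclideanSpace ℝ (Fin d) × EuclideanSpace ℝ (Fin d) =>
    inner ℝ p.1 p.2) hmeas.aemeasurable (by fun_prop), map_classSum_prod N σ μ hkl, integral_prod]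
  · have h (x : EuclideanSpace ℝ (Fin d)) : ∫ y, inner ℝ x y ∂multivariateGaussian
        ((N l : ℝ) • μ l) ((N l * σ ^ 2) • (1 : Matrix (Fin d) (Fin d) ℝ)) =
        inner ℝ x ((N l : ℝ) • μ l) := by
      rw [real_inner_comm, ← integral_inner_multivariateGaussian]
      exact integral_congr_ae (.of_forall fun y => real_inner_comm _ _)
    simp_rw [h, integral_inner_multivariateGaussian, real_inner_smul_left, real_inner_smul_right]
    ring
  · rw [← map_classSum_prod N σ μ hkl, integrable_map_measure (by fun_prop) hmeas.aemeasurable]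
    exact hi

/-- By independence, first average over `x̄_l` with `x̄_k = x` fixed, which gives `⟨x, N_l μ_l⟩² +
N_l σ² ‖x‖²`, then over `x`. Under the scaling the pure noise term `N_k N_l σ⁴ d` is of order `σ²`.
-/
theorem lintegral_inner_classSum_sq_of_ne {k l : Fin c} (hkl : k ≠ l) :
    ∫⁻ X : Dataset d N, ENNReal.ofReal (inner ℝ (classSum X k) (classSum X l) ^ 2)
        ∂trainLaw N σ μ =
      ENNReal.ofReal ((N k * N l * inner ℝ (μ k) (μ l)) ^ 2 + N k * σ ^ 2 * (N l ^ 2 * ‖μ l‖ ^ 2) +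
        N l * σ ^ 2 * (N k ^ 2 * ‖μ k‖ ^ 2 + N k * σ ^ 2 * d)) := by
  have hmeas := (measurable_classSum (d := d) N k).prodMk (measurable_classSum (d := d) N l)
  rw [← lintegral_map (f := fun p : EuclideanSpace ℝ (Fin d) × EuclideanSpace ℝ (Fin d) =>
    ENNReal.ofReal (inner ℝ p.1 p.2 ^ 2)) (by fun_prop) hmeas, map_classSum_prod N σ μ hkl,
    lintegral_prod _ (by fun_prop)]
  have h (x : EuclideanSpace ℝ (Fin d)) : ∫⁻ y, ENNReal.ofReal (inner ℝ x y ^ 2)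
      ∂multivariateGaussian ((N l : ℝ) • μ l) ((N l * σ ^ 2) • (1 : Matrix (Fin d) (Fin d) ℝ)) =
      ENNReal.ofReal (inner ℝ x ((N l : ℝ) • μ l) ^ 2 + N l * σ ^ 2 * ‖x‖ ^ 2) := by
    rw [real_inner_comm, ← lintegral_inner_sq_multivariateGaussian _ _ (by positivity)]
    exact lintegral_congr fun y => by rw [real_inner_comm]
  have hi := (memLp_inner_multivariateGaussian ((N k : ℝ) • μ k) ((N l : ℝ) • μ l)
    ((N k * σ ^ 2) • (1 : Matrix (Fin d) (Fin d) ℝ))).integrable_sq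
  have hj := (integrable_norm_sq_multivariateGaussian ((N k : ℝ) • μ k)
    ((N k * σ ^ 2) • (1 : Matrix (Fin d) (Fin d) ℝ))).const_mul (N l * σ ^ 2)
  simp_rw [h]
  refine (ofReal_integral_eq_lintegral_ofReal (hi.add hj) (.of_forall fun x => ?_)).symm.trans ?_
  · simp only [Pi.zero_apply, Pi.add_apply]
    positivity
  · rw [integral_add' hi hj, integral_const_mul,
      integral_inner_sq_multivariateGaussian _ _ (by positivity),
      integral_norm_sq_multivariateGaussian _ (by positivity)]
    simp only [norm_smul, mul_pow, real_inner_smul_left, real_inner_smul_right, Fintype.card_fin,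
      Real.norm_eq_abs, sq_abs]
    congr 1
    ring

theorem lintegral_inner_classSum_sub_sq (k : Fin c) (u : EuclideanSpace ℝ (Fin d)) :
    ∫⁻ X : Dataset d N, ENNReal.ofReal (inner ℝ (classSum X k - (N k : ℝ) • μ k) u ^ 2)
        ∂trainLaw N σ μ = ENNReal.ofReal (N k * σ ^ 2 * ‖u‖ ^ 2) := by
  have hL := memLp_inner_multivariateGaussian ((N k : ℝ) • μ k) u
    ((N k * σ ^ 2) • (1 : Matrix (Fin d) (Fin d) ℝ))
  rw [← lintegral_map (f := fun x => ENNReal.ofReal (inner ℝ (x - (N k : ℝ) • μ k) u ^ 2))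
    (by fun_prop) (measurable_classSum N k), map_classSum]
  have h1 := evariance_eq_lintegral_ofReal (fun x => inner ℝ x u)
    (multivariateGaussian ((N k : ℝ) • μ k) ((N k * σ ^ 2) • (1 : Matrix (Fin d) (Fin d) ℝ)))
  rw [← hL.ofReal_variance_eq, variance_eq_sub hL, integral_inner_multivariateGaussian] at h1
  simp only [Pi.pow_apply] at h1
  rw [integral_inner_sq_multivariateGaussian _ _ (by positivity), add_sub_cancel_left] at h1
  simp_rw [inner_sub_left, h1]

theorem lintegral_norm_classSum_sub_sq (k : Fin c) :
    ∫⁻ X : Dataset d N, ENNReal.ofReal ((‖classSum X k - (N k : ℝ) • μ k‖ ^ 2 -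
        N k * σ ^ 2 * d) ^ 2) ∂trainLaw N σ μ =
      ENNReal.ofReal ((N k * σ ^ 2) ^ 2 * (d * Var[fun t => t ^ 2; gaussianReal 0 1])) := by
  rw [← lintegral_map (f := fun x => ENNReal.ofReal ((‖x - (N k : ℝ) • μ k‖ ^ 2 -
    N k * σ ^ 2 * d) ^ 2)) (by fun_prop) (measurable_classSum N k), map_classSum]
  simpa using lintegral_norm_sub_sq_sub_sq ((N k : ℝ) • μ k) (v := N k * σ ^ 2) (by positivity)

end ClassSumMoments

/-! ### Limits of the Gram matrix and of the mean scores -/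

section Limits

variable {c : ℕ} (N : Fin c → ℕ) {s : Fin c → ℝ} {σ : ℕ → ℝ}
  {μ : (d : ℕ) → Fin c → EuclideanSpace ℝ (Fin d)}

/-- With `1 / 0 = 0`, dimension zero would force `σ = 0`. -/
theorem ModelScaling.pos {d : ℕ} {σ : ℝ} {μ : Fin c → EuclideanSpace ℝ (Fin d)}
    (h : ModelScaling d s σ μ) : 0 < d := by
  have h1 := h.sigma_pos
  have h2 := h.sigma_sq
  rcases Nat.eq_zero_or_pos d with rfl | hd
  · simp at h2
    exact absurd h2 h1.ne'
  · exact hd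

theorem ModelScaling.sigma_sq_mul {d : ℕ} {σ : ℝ} {μ : Fin c → EuclideanSpace ℝ (Fin d)}
    (h : ModelScaling d s σ μ) : σ ^ 2 * d = 1 := by
  have : (d : ℝ) ≠ 0 := by exact_mod_cast h.pos.ne'
  rw [h.sigma_sq]
  field_simp

/-- Since `σ √d = 1`, the signal `‖μ_i‖²` is exactly `s_i` times the noise level `σ`. This is why
the limiting mean scores are finite constants. -/
theorem ModelScaling.norm_sq_div {d : ℕ} {σ : ℝ} {μ : Fin c → EuclideanSpace ℝ (Fin d)}
    (h : ModelScaling d s σ μ) (i : Fin c) : ‖μ i‖ ^ 2 / σ = s i := by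
  have hd : 0 < √(d : ℝ) := Real.sqrt_pos.2 (by exact_mod_cast h.pos)
  have h1 : σ * √(d : ℝ) = 1 := by
    have : (σ * √(d : ℝ)) ^ 2 = 1 := by
      rw [mul_pow, Real.sq_sqrt (Nat.cast_nonneg d), h.sigma_sq_mul]
    exact (pow_eq_one_iff_of_nonneg (mul_pos h.sigma_pos hd).le two_ne_zero).1 this
  have h2 := h.sigma_pos.ne'
  rw [h.norm_sq, div_div, mul_comm, h1, div_one]

variable (hscale : ∀ᶠ d in atTop, ModelScaling d s (σ d) (μ d))
include hscale

theorem tendsto_norm_sq_mean (i : Fin c) : Tendsto (fun d => ‖μ d i‖ ^ 2) atTop (𝓝 0) := by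
  have h : Tendsto (fun d : ℕ => s i / √(d : ℝ)) atTop (𝓝 0) :=
    tendsto_const_nhds.div_atTop (Real.tendsto_sqrt_atTop.comp tendsto_natCast_atTop_atTop)
  refine h.congr' ?_
  filter_upwards [hscale] with d hd
  exact (hd.norm_sq i).symm

theorem tendsto_sigma_sq : Tendsto (fun d => σ d ^ 2) atTop (𝓝 0) := by
  refine (tendsto_one_div_atTop_nhds_zero_nat (𝕜 := ℝ)).congr' ?_
  filter_upwards [hscale] with d hd
  exact hd.sigma_sq.symm

/-- The limit of the scaled mean scores of the class sums on test points of class `y`. -/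
theorem tendsto_inner_classSum_mean_div (y z : Fin c) :
    Tendsto (fun x : Σ d, Dataset d N => inner ℝ (classSum x.2 z) (μ x.1 y) / σ x.1)
      (probFilter fun d => trainLaw N (σ d) (μ d)) (𝓝 (if z = y then N y * s y else 0)) := by
  -- The noise part has variance `N_z σ² ‖μ_y‖² / σ² = N_z ‖μ_y‖²`, which vanishes because the means
  -- shrink.
  have hnoise := tendsto_probFilter_zero_of_lintegral_sq_le
    (P := fun d => trainLaw N (σ d) (μ d))
    (F := fun d X => inner ℝ (classSum X z - (N z : ℝ) • μ d z) ((σ d)⁻¹ • μ d y))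
    (r := fun d => N z * ‖μ d y‖ ^ 2)
    (fun d => ((measurable_classSum N z).sub_const _).inner_const) (by
      simpa using (tendsto_norm_sq_mean hscale y).const_mul (N z : ℝ)) (by
      filter_upwards [hscale] with d hd
      rw [lintegral_inner_classSum_sub_sq]
      refine ENNReal.ofReal_le_ofReal (le_of_eq ?_)
      have := hd.sigma_pos.ne'
      rw [norm_smul, mul_pow, norm_inv, inv_pow, Real.norm_eq_abs, sq_abs]
      field_simp)
  have hmean : Tendsto (fun d => N z * inner ℝ (μ d z) (μ d y) / σ d) atTop
      (𝓝 (if z = y then N y * s y else 0)) := by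
    refine tendsto_const_nhds.congr' ?_
    filter_upwards [hscale] with d hd
    split_ifs with hzy
    · rw [hzy, real_inner_self_eq_norm_sq, mul_div_assoc, hd.norm_sq_div]
    · rw [hd.orthogonal z y hzy]
      simp
  have h := (hmean.comp tendsto_fst_probFilter).add hnoise
  rw [add_zero] at h
  refine h.congr fun x => ?_
  simp only [Function.comp_apply, inner_sub_left, real_inner_smul_left, real_inner_smul_right]
  ring

/-- The limit of the Gram matrix of the class sums. -/
theorem tendsto_inner_classSum_classSum (z w : Fin c) :
    Tendsto (fun x : Σ d, Dataset d N => inner ℝ (classSum x.2 z) (classSum x.2 w))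
      (probFilter fun d => trainLaw N (σ d) (μ d)) (𝓝 (if z = w then (N z : ℝ) else 0)) := by
  have hσ := tendsto_sigma_sq hscale
  have hz := tendsto_norm_sq_mean hscale z
  have hw := tendsto_norm_sq_mean hscale w
  split_ifs with hzw
  · subst hzw
    -- With `g` the centred class sum, `‖x̄_z‖² = ‖g‖² + 2 ⟨g, N_z μ_z⟩ + N_z² ‖μ_z‖²`. The cross
    -- term vanishes, and `‖g‖²` concentrates at `N_z σ² d = N_z` because its variance is a constant
    -- times `σ⁴ d = σ²`.
    have hcross := tendsto_probFilter_zero_of_lintegral_sq_le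
      (P := fun d => trainLaw N (σ d) (μ d))
      (F := fun d X => inner ℝ (classSum X z - (N z : ℝ) • μ d z) ((N z : ℝ) • μ d z))
      (fun d => ((measurable_classSum N z).sub_const _).inner_const)
      (r := fun d => N z * σ d ^ 2 * (N z ^ 2 * ‖μ d z‖ ^ 2)) (by
        simpa using (hσ.const_mul (N z : ℝ)).mul (hz.const_mul ((N z : ℝ) ^ 2))) (by
        refine .of_forall fun d => ?_
        rw [lintegral_inner_classSum_sub_sq]
        simp [norm_smul, mul_pow])
    have hnoise := tendsto_probFilter_zero_of_lintegral_sq_le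
      (P := fun d => trainLaw N (σ d) (μ d))
      (F := fun d X => ‖classSum X z - (N z : ℝ) • μ d z‖ ^ 2 - N z * σ d ^ 2 * d)
      (fun d => (((measurable_classSum N z).sub_const _).norm.pow_const 2).sub_const _)
      (r := fun d => N z ^ 2 * σ d ^ 2 * Var[fun t => t ^ 2; gaussianReal 0 1]) (by
        simpa using (hσ.const_mul ((N z : ℝ) ^ 2)).mul_const
          Var[fun t => t ^ 2; gaussianReal 0 1]) (by
        filter_upwards [hscale] with d hd
        rw [lintegral_norm_classSum_sub_sq]
        refine ENNReal.ofReal_le_ofReal (le_of_eq ?_)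
        linear_combination (N z ^ 2 * σ d ^ 2 * Var[fun t => t ^ 2; gaussianReal 0 1]) *
          hd.sigma_sq_mul)
    have hdet : Tendsto (fun d => (N z : ℝ) ^ 2 * ‖μ d z‖ ^ 2 + N z * σ d ^ 2 * d) atTop
        (𝓝 (N z : ℝ)) := by
      have h1 : Tendsto (fun d => N z * σ d ^ 2 * d) atTop (𝓝 (N z : ℝ)) := by
        refine tendsto_const_nhds.congr' ?_
        filter_upwards [hscale] with d hd
        rw [mul_assoc, hd.sigma_sq_mul, mul_one]
      simpa using (hz.const_mul ((N z : ℝ) ^ 2)).add h1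
    have h := ((hdet.comp tendsto_fst_probFilter).add (hcross.const_mul 2)).add hnoise
    rw [mul_zero, add_zero, add_zero] at h
    refine h.congr fun x => ?_
    have h1 := norm_add_sq_real (classSum x.2 z - (N z : ℝ) • μ x.1 z) ((N z : ℝ) • μ x.1 z)
    rw [sub_add_cancel, norm_smul ((N z : ℝ)), mul_pow, Real.norm_eq_abs, sq_abs] at h1
    rw [real_inner_self_eq_norm_sq, h1]
    simp only [Function.comp_apply]
    ring
  · refine tendsto_probFilter_zero_of_lintegral_sq_le
      (P := fun d => trainLaw N (σ d) (μ d))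
      (F := fun d X => inner ℝ (classSum X z) (classSum X w))
      (fun d => (measurable_classSum N z).inner (measurable_classSum N w))
      (r := fun d => N z * σ d ^ 2 * (N w ^ 2 * ‖μ d w‖ ^ 2) +
        N w * σ d ^ 2 * (N z ^ 2 * ‖μ d z‖ ^ 2 + N z)) ?_ ?_
    · simpa using ((hσ.const_mul (N z : ℝ)).mul (hw.const_mul ((N w : ℝ) ^ 2))).add
        ((hσ.const_mul (N w : ℝ)).mul ((hz.const_mul ((N z : ℝ) ^ 2)).add_const (N z : ℝ)))
    · filter_upwards [hscale] with d hd
      rw [lintegral_inner_classSum_sq_of_ne _ _ _ hzw, hd.orthogonal z w hzw]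
      refine ENNReal.ofReal_le_ofReal (le_of_eq ?_)
      linear_combination (N w * σ d ^ 2 * N z) * hd.sigma_sq_mul

end Limits

/-! ### The score gaps as affine images of Gaussian vectors -/

section ScoreGap

variable {c d : ℕ}

/-- The coefficient differences `α_y - α_i`, as the rows of a matrix. -/
def gapMatrix (α : Fin c → Fin c → ℝ) (y : Fin c) : Matrix (Fin c) (Fin c) ℝ :=
  Matrix.of fun i z => α y z - α i z

/-- The gaps between the score of class `y` and the scores of all classes, divided by `σ`, as a
function of the scaled scores `t` of the class sums. -/
noncomputable def scoreGap (σ : ℝ) (α : Fin c → Fin c → ℝ) (b : Fin c → ℝ) (y : Fin c)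
    (t : EuclideanSpace ℝ (Fin c)) : EuclideanSpace ℝ (Fin c) :=
  toLp 2 (gapMatrix α y *ᵥ ofLp t) + toLp 2 fun i => (b y - b i) / σ

/-- The scaled scores for which class `y` is in the argmax set. -/
def correctRegion (σ : ℝ) (α : Fin c → Fin c → ℝ) (b : Fin c → ℝ) (y : Fin c) :
    Set (EuclideanSpace ℝ (Fin c)) :=
  {t | ∀ i, 0 ≤ scoreGap σ α b y t i}

/-- The scaled scores for which class `k` beats class `y`. -/
def beatRegion (σ : ℝ) (α : Fin c → Fin c → ℝ) (b : Fin c → ℝ) (y k : Fin c) :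
    Set (EuclideanSpace ℝ (Fin c)) :=
  {t | scoreGap σ α b y t k < 0}

/-- The scaled scores of the vectors `v z` at the point `x`. -/
noncomputable def scaledScores (σ : ℝ) (v : Fin c → EuclideanSpace ℝ (Fin d))
    (x : EuclideanSpace ℝ (Fin d)) : EuclideanSpace ℝ (Fin c) :=
  toLp 2 fun z => inner ℝ (v z) x / σ

theorem measurable_scoreGap (σ : ℝ) (α : Fin c → Fin c → ℝ) (b : Fin c → ℝ) (y : Fin c) :
    Measurable (scoreGap σ α b y) := by
  refine Continuous.measurable ?_
  unfold scoreGap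
  fun_prop

theorem measurableSet_nonneg :
    MeasurableSet {v : EuclideanSpace ℝ (Fin c) | ∀ i, 0 ≤ v i} := by
  rw [Set.ofPred_forall]
  exact .iInter fun i => measurableSet_le measurable_const (by fun_prop)

theorem measurableSet_correctRegion (σ : ℝ) (α : Fin c → Fin c → ℝ) (b : Fin c → ℝ) (y : Fin c) :
    MeasurableSet (correctRegion σ α b y) :=
  measurable_scoreGap σ α b y measurableSet_nonneg

theorem measurableSet_beatRegion (σ : ℝ) (α : Fin c → Fin c → ℝ) (b : Fin c → ℝ) (y k : Fin c) :
    MeasurableSet (beatRegion σ α b y k) :=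
  measurableSet_lt (by have := measurable_scoreGap σ α b y; fun_prop) measurable_const

theorem beatRegion_subset (σ : ℝ) (α : Fin c → Fin c → ℝ) (b : Fin c → ℝ) (y k : Fin c) :
    beatRegion σ α b y k ⊆ (correctRegion σ α b y)ᶜ :=
  fun _ ht h => (h k).not_gt ht

/-- Dividing the scores by `σ` cancels the test noise variance, which leaves the Gram matrix as
covariance. -/
theorem map_scaledScores_classLaw {σ : ℝ} (hσ : 0 < σ) (m : EuclideanSpace ℝ (Fin d))
    (v : Fin c → EuclideanSpace ℝ (Fin d)) :
    (classLaw σ m).map (scaledScores σ v) =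
      multivariateGaussian (scaledScores σ v m) (gram ℝ v) := by
  have hV (x : EuclideanSpace ℝ (Fin d)) :
      toLp 2 ((Matrix.of fun z j => v z j / σ) *ᵥ ofLp x) + 0 = scaledScores σ v x := by
    ext z
    simp only [scaledScores, add_zero, mulVec, dotProduct, of_apply,
      EuclideanSpace.inner_eq_star_dotProduct, star_trivial, Finset.sum_div]
    exact Finset.sum_congr rfl fun j _ => by ring
  have h := multivariateGaussian_map_affine m (posSemidef_smul_one (sq_nonneg σ))
    (Matrix.of fun z j => v z j / σ) 0
  simp_rw [hV] at h
  rw [classLaw, h]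
  congr 1
  ext z w
  rw [Matrix.mul_smul, Matrix.mul_one, Matrix.smul_mul, Matrix.smul_apply, mul_apply, gram_apply,
    smul_eq_mul, Finset.mul_sum, EuclideanSpace.inner_eq_star_dotProduct, dotProduct]
  refine Finset.sum_congr rfl fun j _ => ?_
  simp only [of_apply, transpose_apply, star_trivial]
  field_simp

theorem scoreGap_scaledScores {N : Fin c → ℕ} (σ : ℝ) (α : Fin c → Fin c → ℝ)
    (b : Fin c → ℝ) (y i : Fin c) (X : Dataset d N) (x : EuclideanSpace ℝ (Fin d)) :
    scoreGap σ α b y (scaledScores σ (classSum X) x) i =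
      (scores (weights α X) b x y - scores (weights α X) b x i) / σ := by
  simp only [scoreGap, scaledScores, gapMatrix, scores, weights, PiLp.add_apply, mulVec,
    dotProduct, of_apply, sum_inner, real_inner_smul_left, sub_mul, Finset.sum_sub_distrib,
    ← mul_div_assoc, ← Finset.sum_div]
  ring

theorem measurable_scaledScores (σ : ℝ) (v : Fin c → EuclideanSpace ℝ (Fin d)) :
    Measurable (scaledScores σ v) := by
  refine Continuous.measurable ?_
  unfold scaledScores
  fun_prop

/-- Separates the randomness of the training set, which sits in the Gaussian parameters, from the
coefficients, which sit in the region. Ties count as correct, hence the weak inequalities; the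
coordinate `y` of the gap is always zero. -/
theorem err_eq {N : Fin c → ℕ} {σ : ℝ} (hσ : 0 < σ) (μ : Fin c → EuclideanSpace ℝ (Fin d))
    (α : Fin c → Fin c → ℝ) (b : Fin c → ℝ) (y : Fin c) (X : Dataset d N) :
    err σ μ (weights α X) b y =
      1 - (multivariateGaussian (scaledScores σ (classSum X) (μ y)) (gram ℝ (classSum X))).real
        (correctRegion σ α b y) := by
  have hS := measurableSet_correctRegion σ α b y
  have hT := measurable_scaledScores σ (classSum X)
  have hind : (fun x => zeroOneLoss (scores (weights α X) b x) y) =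
      (scaledScores σ (classSum X) ⁻¹' (correctRegion σ α b y)ᶜ).indicator 1 := by
    ext x
    have hiff : y ∈ {i | ∀ j, scores (weights α X) b x j ≤ scores (weights α X) b x i} ↔
        scaledScores σ (classSum X) x ∈ correctRegion σ α b y := by
      refine forall_congr' fun i => ?_
      rw [scoreGap_scaledScores, le_div_iff₀ hσ, zero_mul, sub_nonneg]
    rw [zeroOneLoss]
    by_cases h : scaledScores σ (classSum X) x ∈ correctRegion σ α b y
    · rw [if_pos (hiff.2 h), Set.indicator_of_notMem (by simpa using h)]
    · rw [if_neg (fun h' => h (hiff.1 h')), Set.indicator_of_mem (by simpa using h), Pi.one_apply]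
  rw [err, hind, integral_indicator_one (hT hS.compl), ← probReal_compl_eq_one_sub hS,
    ← map_scaledScores_classLaw hσ, map_measureReal_apply hT hS.compl]

theorem errTo_eq {N : Fin c → ℕ} {σ : ℝ} (hσ : 0 < σ) (μ : Fin c → EuclideanSpace ℝ (Fin d))
    (α : Fin c → Fin c → ℝ) (b : Fin c → ℝ) (y k : Fin c) (X : Dataset d N) :
    errTo σ μ (weights α X) b y k =
      (multivariateGaussian (scaledScores σ (classSum X) (μ y)) (gram ℝ (classSum X))).real
        (beatRegion σ α b y k) := by
  rw [errTo, ← map_scaledScores_classLaw hσ, map_measureReal_apply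
    (measurable_scaledScores σ (classSum X)) (measurableSet_beatRegion σ α b y k)]
  congr 1
  ext x
  simp only [beatRegion, Set.mem_preimage, Set.mem_ofPred_eq]
  rw [scoreGap_scaledScores, div_lt_iff₀ hσ, zero_mul, sub_neg, gt_iff_lt]

theorem errTo_le_err {N : Fin c → ℕ} {σ : ℝ} (hσ : 0 < σ) (μ : Fin c → EuclideanSpace ℝ (Fin d))
    (α : Fin c → Fin c → ℝ) (b : Fin c → ℝ) (y k : Fin c) (X : Dataset d N) :
    errTo σ μ (weights α X) b y k ≤ err σ μ (weights α X) b y := by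
  rw [err_eq hσ, errTo_eq hσ, ← probReal_compl_eq_one_sub (measurableSet_correctRegion σ α b y)]
  exact measureReal_mono (beatRegion_subset σ α b y k)

theorem err_le_worstClassErr (σ : ℝ) (μ : Fin c → EuclideanSpace ℝ (Fin d))
    (W : Fin c → EuclideanSpace ℝ (Fin d)) (b : Fin c → ℝ) (y : Fin c) :
    err σ μ W b y ≤ worstClassErr σ μ W b :=
  le_ciSup (f := fun y => err σ μ W b y) (Set.finite_range _).bddAbove y

end ScoreGap

/-! ### The expected score statistics -/

section Expected

variable {c d : ℕ} (N : Fin c → ℕ) {s : Fin c → ℝ} {σ : ℝ}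
  {μ : Fin c → EuclideanSpace ℝ (Fin d)} (α : Fin c → Fin c → ℝ) (b : Fin c → ℝ)

theorem weights_sub_weights (X : Dataset d N) (y i : Fin c) :
    weights α X y - weights α X i = ∑ z, (α y z - α i z) • classSum X z := by
  simp [weights, sub_smul, Finset.sum_sub_distrib]

theorem integrable_scoreMean (σ : ℝ) (μ : Fin c → EuclideanSpace ℝ (Fin d)) (y i : Fin c) :
    Integrable (fun X : Dataset d N => scoreMean σ μ (weights α X) b y i) (trainLaw N σ μ) := by
  simp only [scoreMean, weights_sub_weights, sum_inner, real_inner_smul_left]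
  refine (((integrable_finsetSum _ fun z _ => ?_).add (integrable_const _)).sub
    (integrable_const _)).div_const _
  exact (integrable_inner_classSum N σ μ z _).const_mul _

theorem expScoreMean_apply (hμ : ∀ i j, i ≠ j → inner ℝ (μ i) (μ j) = 0) (y i : Fin c) :
    expScoreMean N σ μ α b y i =
      ((α y y - α i y) * N y * ‖μ y‖ ^ 2 + b y - b i) / σ := by
  have hint (z : Fin c) := (integrable_inner_classSum N σ μ z (μ y)).const_mul (α y z - α i z)
  have hsum := integrable_finsetSum Finset.univ fun z _ => hint z
  simp only [expScoreMean, scoreMean, weights_sub_weights, sum_inner, real_inner_smul_left]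
  simp_rw [add_sub_assoc]
  rw [integral_div, integral_add hsum (integrable_const _),
    integral_finsetSum _ fun z _ => hint z]
  simp_rw [integral_const_mul, integral_inner_classSum]
  rw [Finset.sum_eq_single y (fun z _ hz => by rw [hμ z y hz]; ring) (by simp)]
  simp
  ring

theorem scoreCov_weights (X : Dataset d N) (y i j : Fin c) :
    scoreCov (weights α X) y i j = ∑ z, ∑ w, (α y z - α i z) * (α y w - α j w) *
      inner ℝ (classSum X z) (classSum X w) := by
  rw [scoreCov, weights_sub_weights, weights_sub_weights, sum_inner]
  refine Finset.sum_congr rfl fun z _ => ?_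
  rw [inner_sum]
  refine Finset.sum_congr rfl fun w _ => ?_
  rw [real_inner_smul_left, real_inner_smul_right]
  ring

theorem integrable_scoreCov (σ : ℝ) (μ : Fin c → EuclideanSpace ℝ (Fin d)) (y i j : Fin c) :
    Integrable (fun X : Dataset d N => scoreCov (weights α X) y i j) (trainLaw N σ μ) := by
  simp only [scoreCov_weights]
  exact integrable_finsetSum _ fun z _ => integrable_finsetSum _ fun w _ =>
    (integrable_inner_classSum_classSum N σ μ z w).const_mul _

variable {N}

theorem sq_mul_xi (hN : ∀ i, 0 < N i) (z : Fin c) :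
    (N z : ℝ) ^ 2 * xi N σ μ z = N z ^ 2 * ‖μ z‖ ^ 2 + N z * σ ^ 2 * d := by
  have : (N z : ℝ) ≠ 0 := by exact_mod_cast (hN z).ne'
  rw [xi]
  field_simp

/-- Independence and orthogonality kill the off-diagonal terms. The diagonal ones are `𝔼 ‖x̄_z‖² =
N_z² ξ_z`. -/
theorem expScoreCov_apply (hN : ∀ i, 0 < N i) (hμ : ∀ i j, i ≠ j → inner ℝ (μ i) (μ j) = 0)
    (y i j : Fin c) :
    expScoreCov N σ μ α y i j =
      ∑ z, (α y z - α i z) * (α y z - α j z) * (N z : ℝ) ^ 2 * xi N σ μ z := by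
  have hint (z w : Fin c) := (integrable_inner_classSum_classSum N σ μ z w).const_mul
    ((α y z - α i z) * (α y w - α j w))
  simp only [expScoreCov, scoreCov_weights, of_apply]
  rw [integral_finsetSum _ fun z _ => integrable_finsetSum _ fun w _ => hint z w]
  refine Finset.sum_congr rfl fun z _ => ?_
  rw [integral_finsetSum _ fun w _ => hint z w]
  simp_rw [integral_const_mul]
  rw [Finset.sum_eq_single z (fun w _ hw => by
    rw [integral_inner_classSum_of_ne N σ μ hw.symm, hμ z w hw.symm]; ring) (by simp)]
  simp_rw [real_inner_self_eq_norm_sq]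
  rw [integral_norm_sq_classSum, mul_assoc _ _ (xi N σ μ z), sq_mul_xi hN]

variable (N σ μ) in
/-- The mean of the limiting law of the scaled scores of the class sums. -/
noncomputable def approxMean (y : Fin c) : EuclideanSpace ℝ (Fin c) :=
  toLp 2 fun z => if z = y then N y * (‖μ y‖ ^ 2 / σ) else 0

variable (N σ μ) in
/-- The covariance of the limiting law of the scaled scores of the class sums. -/
noncomputable def approxCov : Matrix (Fin c) (Fin c) ℝ :=
  diagonal fun z => (N z : ℝ) ^ 2 * xi N σ μ z

theorem xi_pos (h : ModelScaling d s σ μ) (hN : ∀ i, 0 < N i) (z : Fin c) : 0 < xi N σ μ z := by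
  have : (0 : ℝ) < N z := by exact_mod_cast hN z
  rw [xi, h.sigma_sq_mul]
  positivity

theorem posSemidef_approxCov (h : ModelScaling d s σ μ) (hN : ∀ i, 0 < N i) :
    (approxCov N σ μ).PosSemidef :=
  PosSemidef.diagonal fun z => mul_nonneg (sq_nonneg _) (xi_pos h hN z).le

theorem gapMatrix_mul_approxCov_mul (h : ModelScaling d s σ μ) (hN : ∀ i, 0 < N i) (y : Fin c) :
    gapMatrix α y * approxCov N σ μ * (gapMatrix α y)ᵀ = expScoreCov N σ μ α y := by
  ext i j
  rw [expScoreCov_apply α hN h.orthogonal, approxCov, mul_apply]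
  refine Finset.sum_congr rfl fun z _ => ?_
  rw [mul_diagonal, transpose_apply, gapMatrix, of_apply, of_apply]
  ring

/-- An exact identity at every scaled dimension: it moves the coefficients from the Gaussian
parameters `ν̂`, `Σ̂` into the region. -/
theorem map_scoreGap_approx (h : ModelScaling d s σ μ) (hN : ∀ i, 0 < N i) (y : Fin c) :
    (multivariateGaussian (approxMean N σ μ y) (approxCov N σ μ)).map (scoreGap σ α b y) =
      multivariateGaussian (expScoreMean N σ μ α b y) (expScoreCov N σ μ α y) := by
  unfold scoreGap
  rw [multivariateGaussian_map_affine _ (posSemidef_approxCov h hN)]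
  congr 1
  · ext i
    rw [expScoreMean_apply N α b h.orthogonal]
    simp [approxMean, gapMatrix, mulVec, dotProduct]
    ring
  · exact gapMatrix_mul_approxCov_mul α h hN y

theorem approxErr_eq (h : ModelScaling d s σ μ) (hN : ∀ i, 0 < N i) (y : Fin c) :
    approxErr N σ μ α b y =
      1 - (multivariateGaussian (approxMean N σ μ y) (approxCov N σ μ)).real
        (correctRegion σ α b y) := by
  rw [approxErr, ← map_scoreGap_approx α b h hN, map_measureReal_apply
    (measurable_scoreGap σ α b y) measurableSet_nonneg]
  rfl

theorem gaussianReal_real_Iio_zero (a : ℝ) {v : ℝ} (hv : 0 < v) :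
    (gaussianReal a v.toNNReal).real (Set.Iio 0) = gaussianQ (a / √v) := by
  -- The reflected parametrisation turns the lower ray at `0` into the upper ray at `a / √v`.
  have h1 : (gaussianReal 0 1).map (fun t => a - √v * t) = gaussianReal a v.toNNReal := by
    have : (fun t => a - √v * t) = (fun t => a - t) ∘ fun t => √v * t := rfl
    rw [this, ← Measure.map_map (by fun_prop) (by fun_prop), gaussianReal_map_const_mul,
      gaussianReal_map_const_sub]
    congr 1
    · simp
    · ext
      simp [Real.sq_sqrt hv.le, hv.le]
  rw [← h1, map_measureReal_apply (by fun_prop) measurableSet_Iio, gaussianQ]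
  congr 1
  ext t
  simp [div_lt_iff₀ (Real.sqrt_pos.2 hv), mul_comm]

/-- The `k`-th marginal of `N(ν̂, Σ̂)` is a real Gaussian, and `α y ≠ α k` makes its variance
positive. With equal coefficients the gap is deterministic, while the `Q` term reads `Q(0) = 1/2` by
the convention for division by zero. -/
theorem approxErrTo_eq (h : ModelScaling d s σ μ) (hN : ∀ i, 0 < N i) {y k : Fin c}
    (hα : α y ≠ α k) :
    approxErrTo N σ μ α b y k =
      (multivariateGaussian (approxMean N σ μ y) (approxCov N σ μ)).real
        (beatRegion σ α b y k) := by
  have hpsd : (expScoreCov N σ μ α y).PosSemidef := by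
    rw [← gapMatrix_mul_approxCov_mul α h hN]
    simpa using (posSemidef_approxCov h hN).mul_mul_conjTranspose_same (gapMatrix α y)
  have hcov : expScoreCov N σ μ α y k k =
      ∑ i, (α y i - α k i) ^ 2 * (N i : ℝ) ^ 2 * xi N σ μ i := by
    rw [expScoreCov_apply α hN h.orthogonal]
    simp_rw [sq (α y _ - α k _)]
  have hpos : 0 < expScoreCov N σ μ α y k k := by
    rw [hcov]
    obtain ⟨z, hz⟩ := Function.ne_iff.1 hα
    refine Finset.sum_pos' (fun i _ => ?_) ⟨z, Finset.mem_univ z, ?_⟩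
    · have := (xi_pos h hN i).le
      positivity
    · have h1 := xi_pos h hN z
      have h2 : (0 : ℝ) < N z := by exact_mod_cast hN z
      have h3 : α y z - α k z ≠ 0 := sub_ne_zero.2 hz
      positivity
  have hset : beatRegion σ α b y k = scoreGap σ α b y ⁻¹' ((fun v => v k) ⁻¹' Set.Iio 0) := rfl
  rw [hset, ← map_measureReal_apply (measurable_scoreGap σ α b y)
    (measurableSet_Iio.preimage (by fun_prop)), map_scoreGap_approx α b h hN,
    ← map_measureReal_apply (by fun_prop) measurableSet_Iio,
    (measurePreserving_eval_multivariateGaussian hpsd).map_eq, gaussianReal_real_Iio_zero _ hpos,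
    expScoreMean_apply N α b h.orthogonal, hcov, approxErrTo, div_div]

end Expected

/-! ### Convergence of the class errors -/

section ErrLimits

variable {c : ℕ} {N : Fin c → ℕ} {s : Fin c → ℝ} {σ : ℕ → ℝ}
  {μ : (d : ℕ) → Fin c → EuclideanSpace ℝ (Fin d)}

/-- The law of the scaled scores of the class sums on a test point of class `y` is close in total
variation to its deterministic approximation, with high probability over the training set. -/
theorem eventually_abs_scaledScores_law_sub_le (hN : ∀ i, 0 < N i)
    (hscale : ∀ᶠ d in atTop, ModelScaling d s (σ d) (μ d)) (y : Fin c) {ε : ℝ} (hε : 0 < ε) :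
    ∀ᶠ x : Σ d, Dataset d N in probFilter fun d => trainLaw N (σ d) (μ d),
      ∀ A, MeasurableSet A →
        |(multivariateGaussian (scaledScores (σ x.1) (classSum x.2) (μ x.1 y))
            (gram ℝ (classSum x.2))).real A -
          (multivariateGaussian (approxMean N (σ x.1) (μ x.1) y)
            (approxCov N (σ x.1) (μ x.1))).real A| ≤ ε := by
  set m₀ : EuclideanSpace ℝ (Fin c) := toLp 2 fun z => if z = y then N y * s y else 0
  set S₀ : Matrix (Fin c) (Fin c) ℝ := diagonal fun z => (N z : ℝ)
  -- Nondegeneracy of the limit is where nonempty classes matter. Both laws are compared with `N(m₀,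
  -- S₀)`, each at cost `ε / 2`.
  have hS₀ : S₀.PosDef := PosDef.diagonal fun z => by exact_mod_cast hN z
  have hclose := eventually_abs_multivariateGaussian_sub_le m₀ hS₀ (half_pos hε)
  have hrandom : Tendsto (fun x : Σ d, Dataset d N =>
      (scaledScores (σ x.1) (classSum x.2) (μ x.1 y), gram ℝ (classSum x.2)))
      (probFilter fun d => trainLaw N (σ d) (μ d)) (𝓝 (m₀, S₀)) := by
    refine Tendsto.prodMk_nhds ?_ ?_
    · exact ((PiLp.continuous_toLp 2 _).tendsto _).comp
        (tendsto_pi_nhds.2 fun z => tendsto_inner_classSum_mean_div N hscale y z)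
    · refine tendsto_pi_nhds.2 fun z => tendsto_pi_nhds.2 fun w => ?_
      simp only [S₀, diagonal_apply]
      exact tendsto_inner_classSum_classSum N hscale z w
  have happrox : Tendsto (fun d => (approxMean N (σ d) (μ d) y, approxCov N (σ d) (μ d))) atTop
      (𝓝 (m₀, S₀)) := by
    refine Tendsto.prodMk_nhds ?_ ?_
    · refine tendsto_const_nhds.congr' ?_
      filter_upwards [hscale] with d hd
      rw [approxMean, hd.norm_sq_div]
    · refine tendsto_pi_nhds.2 fun z => tendsto_pi_nhds.2 fun w => ?_
      simp only [S₀, approxCov, diagonal_apply]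
      split_ifs with hzw
      · have h := ((tendsto_norm_sq_mean hscale z).const_mul ((N z : ℝ) ^ 2)).add_const (N z : ℝ)
        rw [mul_zero, zero_add] at h
        refine h.congr' ?_
        filter_upwards [hscale] with d hd
        rw [sq_mul_xi hN, mul_assoc (N z : ℝ), hd.sigma_sq_mul, mul_one]
      · exact tendsto_const_nhds
  filter_upwards [hrandom.eventually hclose, tendsto_fst_probFilter.eventually
    (happrox.eventually hclose), tendsto_fst_probFilter.eventually hscale] with x h1 h2 h3 A hA
  have h4 := h1 (posSemidef_gram ℝ _) A hA
  have h5 := h2 (posSemidef_approxCov h3 hN) A hA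
  rw [abs_sub_comm] at h5
  exact (abs_sub_le _ _ _).trans (by linarith)

variable (hN : ∀ i, 0 < N i) (hscale : ∀ᶠ d in atTop, ModelScaling d s (σ d) (μ d))
  (α : ℕ → Fin c → Fin c → ℝ) (b : ℕ → Fin c → ℝ)
include hN hscale

theorem eventually_abs_err_sub_le (y : Fin c) {ε : ℝ} (hε : 0 < ε) :
    ∀ᶠ x : Σ d, Dataset d N in probFilter fun d => trainLaw N (σ d) (μ d),
      |err (σ x.1) (μ x.1) (weights (α x.1) x.2) (b x.1) y -
        approxErr N (σ x.1) (μ x.1) (α x.1) (b x.1) y| ≤ ε := by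
  filter_upwards [eventually_abs_scaledScores_law_sub_le hN hscale y hε,
    tendsto_fst_probFilter.eventually hscale] with x h1 h2
  rw [err_eq h2.sigma_pos, approxErr_eq _ _ h2 hN, sub_sub_sub_cancel_left, abs_sub_comm]
  exact h1 _ (measurableSet_correctRegion _ _ _ _)

theorem eventually_abs_errTo_sub_le {y k : Fin c} (hα : ∀ᶠ d in atTop, α d y ≠ α d k)
    {ε : ℝ} (hε : 0 < ε) :
    ∀ᶠ x : Σ d, Dataset d N in probFilter fun d => trainLaw N (σ d) (μ d),
      |errTo (σ x.1) (μ x.1) (weights (α x.1) x.2) (b x.1) y k -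
        approxErrTo N (σ x.1) (μ x.1) (α x.1) (b x.1) y k| ≤ ε := by
  filter_upwards [eventually_abs_scaledScores_law_sub_le hN hscale y hε,
    tendsto_fst_probFilter.eventually hscale, tendsto_fst_probFilter.eventually hα] with x h1 h2 h3
  rw [errTo_eq h2.sigma_pos, approxErrTo_eq _ _ h2 hN h3]
  exact h1 _ (measurableSet_beatRegion _ _ _ _ _)

theorem eventually_abs_worstClassErr_sub_le [NeZero c] {ε : ℝ} (hε : 0 < ε) :
    ∀ᶠ x : Σ d, Dataset d N in probFilter fun d => trainLaw N (σ d) (μ d),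
      |worstClassErr (σ x.1) (μ x.1) (weights (α x.1) x.2) (b x.1) -
        ⨆ y, approxErr N (σ x.1) (μ x.1) (α x.1) (b x.1) y| ≤ ε := by
  -- With finitely many classes the bounds hold simultaneously with high probability, and a maximum
  -- moves by no more than its entries do.
  filter_upwards [eventually_all.2 fun y => eventually_abs_err_sub_le hN hscale α b y hε]
    with x hx
  rw [abs_sub_le_iff, sub_le_iff_le_add, sub_le_iff_le_add]
  constructor
  · refine ciSup_le fun y => ?_
    have h1 := (abs_sub_le_iff.1 (hx y)).1
    have h2 := le_ciSup (f := fun y => approxErr N (σ x.1) (μ x.1) (α x.1) (b x.1) y)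
      (Set.finite_range _).bddAbove y
    linarith
  · refine ciSup_le fun y => ?_
    have h1 := (abs_sub_le_iff.1 (hx y)).2
    have h2 := err_le_worstClassErr (σ x.1) (μ x.1) (weights (α x.1) x.2) (b x.1) y
    linarith

end ErrLimits

end ImbalancedMixture

theorem mainTheorem8 (c : ℕ) (hc : 2 ≤ c) (N : Fin c → ℕ) (hN : ∀ i, 0 < N i)
    (s : Fin c → ℝ) (σ : ℕ → ℝ) (μ : (d : ℕ) → Fin c → EuclideanSpace ℝ (Fin d))
    (hscale : ∀ᶠ d in atTop, ModelScaling d s (σ d) (μ d))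
    (α : ℕ → Fin c → Fin c → ℝ) (b : ℕ → Fin c → ℝ) :
    -- the expected score statistics exist and are given explicitly
    (∀ d, ModelScaling d s (σ d) (μ d) → ∀ y,
      (∀ i,
        Integrable (fun X : Dataset d N => scoreMean (σ d) (μ d) (weights (α d) X) (b d) y i)
          (trainLaw N (σ d) (μ d)) ∧
        expScoreMean N (σ d) (μ d) (α d) (b d) y i =
          ((α d y y - α d i y) * N y * ‖μ d y‖ ^ 2 + b d y - b d i) / σ d) ∧
      (∀ i j,
        Integrable (fun X : Dataset d N => scoreCov (weights (α d) X) y i j)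
          (trainLaw N (σ d) (μ d)) ∧
        expScoreCov N (σ d) (μ d) (α d) y i j =
          ∑ z, (α d y z - α d i z) * (α d y z - α d j z) * (N z : ℝ) ^ 2 *
            xi N (σ d) (μ d) z)) ∧
    -- the limit of the class errors
    (∀ y,
      TendstoInProb (fun d => trainLaw N (σ d) (μ d))
        (fun d X => err (σ d) (μ d) (weights (α d) X) (b d) y)
        (fun d => approxErr N (σ d) (μ d) (α d) (b d) y) ∧
      ∀ l : ℝ, Tendsto (fun d => approxErr N (σ d) (μ d) (α d) (b d) y) atTop (𝓝 l) →
        TendstoInProb (fun d => trainLaw N (σ d) (μ d))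
          (fun d X => err (σ d) (μ d) (weights (α d) X) (b d) y) (fun _ => l)) ∧
    -- the limit of the worst class error
    TendstoInProb (fun d => trainLaw N (σ d) (μ d))
      (fun d X => worstClassErr (σ d) (μ d) (weights (α d) X) (b d))
      (fun d => ⨆ y, approxErr N (σ d) (μ d) (α d) (b d) y) ∧
    -- the limit of the pairwise errors
    (∀ y k, k ≠ y → (∀ᶠ d in atTop, α d y ≠ α d k) →
      TendstoInProb (fun d => trainLaw N (σ d) (μ d))
        (fun d X => errTo (σ d) (μ d) (weights (α d) X) (b d) y k)
        (fun d => approxErrTo N (σ d) (μ d) (α d) (b d) y k)) ∧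
    -- the lower bound on the worst class error
    ((∀ y k, k ≠ y → ∀ᶠ d in atTop, α d y ≠ α d k) →
      (∀ ε : ℝ, 0 < ε →
        Tendsto (fun d => trainLaw N (σ d) (μ d)
          {X | worstClassErr (σ d) (μ d) (weights (α d) X) (b d) <
            maxPairs (approxErrTo N (σ d) (μ d) (α d) (b d)) - ε}) atTop (𝓝 0)) ∧
      ∀ q : Fin c → Fin c → ℝ,
        (∀ y k, k ≠ y →
          Tendsto (fun d => approxErrTo N (σ d) (μ d) (α d) (b d) y k) atTop (𝓝 (q y k))) →
        (∀ y k, k ≠ y →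
          TendstoInProb (fun d => trainLaw N (σ d) (μ d))
            (fun d X => errTo (σ d) (μ d) (weights (α d) X) (b d) y k) (fun _ => q y k)) ∧
        ∀ l : ℝ,
          TendstoInProb (fun d => trainLaw N (σ d) (μ d))
            (fun d X => worstClassErr (σ d) (μ d) (weights (α d) X) (b d)) (fun _ => l) →
          maxPairs q ≤ l) := by
  have : NeZero c := ⟨by omega⟩
  -- At least two classes are needed for `maxPairs` to be a supremum over a nonempty set.
  have hpairs : Nonempty {p : Fin c × Fin c // p.2 ≠ p.1} :=
    ⟨⟨(⟨0, by omega⟩, ⟨1, by omega⟩), by simp⟩⟩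
  have herr (y : Fin c) : TendstoInProb (fun d => trainLaw N (σ d) (μ d))
      (fun d X => err (σ d) (μ d) (weights (α d) X) (b d) y)
      (fun d => approxErr N (σ d) (μ d) (α d) (b d) y) :=
    tendstoInProb_of_eventually_abs_sub_le fun ε hε =>
      eventually_abs_err_sub_le hN hscale α b y hε
  have herrTo (y k : Fin c) (hα : ∀ᶠ d in atTop, α d y ≠ α d k) :
      TendstoInProb (fun d => trainLaw N (σ d) (μ d))
        (fun d X => errTo (σ d) (μ d) (weights (α d) X) (b d) y k)
        (fun d => approxErrTo N (σ d) (μ d) (α d) (b d) y k) :=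
    tendstoInProb_of_eventually_abs_sub_le fun ε hε =>
      eventually_abs_errTo_sub_le hN hscale α b hα hε
  -- Being beaten by `k` is a misclassification, so this holds for every training set once `d` is in
  -- the scaling regime.
  have hle : ∀ᶠ x : Σ d, Dataset d N in probFilter fun d => trainLaw N (σ d) (μ d), ∀ y k,
      errTo (σ x.1) (μ x.1) (weights (α x.1) x.2) (b x.1) y k ≤
        worstClassErr (σ x.1) (μ x.1) (weights (α x.1) x.2) (b x.1) := by
    filter_upwards [tendsto_fst_probFilter.eventually hscale] with x hx y k
    exact (errTo_le_err hx.sigma_pos _ _ _ _ _ _).trans (err_le_worstClassErr _ _ _ _ _)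
  refine ⟨fun d hd y => ⟨fun i => ⟨integrable_scoreMean N _ _ _ _ _ _,
    expScoreMean_apply N _ _ hd.orthogonal y i⟩, fun i j => ⟨integrable_scoreCov N _ _ _ _ _ _,
    expScoreCov_apply _ hN hd.orthogonal y i j⟩⟩, fun y => ⟨herr y, fun l hl =>
    (herr y).const_of_tendsto hl⟩, tendstoInProb_of_eventually_abs_sub_le fun ε hε =>
    eventually_abs_worstClassErr_sub_le hN hscale α b hε, fun y k _ => herrTo y k,
    fun hα => ⟨fun ε hε => ?_, fun q hq => ?_⟩⟩
  · have hev : ∀ᶠ x : Σ d, Dataset d N in probFilter fun d => trainLaw N (σ d) (μ d),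
        ¬ worstClassErr (σ x.1) (μ x.1) (weights (α x.1) x.2) (b x.1) <
          maxPairs (approxErrTo N (σ x.1) (μ x.1) (α x.1) (b x.1)) - ε := by
      filter_upwards [hle, eventually_all.2 fun p : {p : Fin c × Fin c // p.2 ≠ p.1} =>
        eventually_abs_errTo_sub_le hN hscale α b (hα p.1.1 p.1.2 p.2) hε] with x h1 h2
      rw [not_lt, sub_le_iff_le_add]
      refine ciSup_le fun p => ?_
      linarith [(abs_sub_le_iff.1 (h2 p)).2, h1 p.1.1 p.1.2]
    simpa only [not_not] using eventually_probFilter.1 hev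
  · have hlim (y k : Fin c) (hk : k ≠ y) := (herrTo y k (hα y k hk)).const_of_tendsto (hq y k hk)
    refine ⟨hlim, fun l hl => ciSup_le fun p => ?_⟩
    have := probFilter_neBot (P := fun d => trainLaw N (σ d) (μ d))
    exact le_of_tendsto_of_tendsto (tendstoInProb_const_iff.1 (hlim p.1.1 p.1.2 p.2))
      (tendstoInProb_const_iff.1 hl) (hle.mono fun x hx => hx _ _)
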